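/- **Definitions.** A *cell complex* (cc) is a set $K$ of non-empty subsets ("cells") of a finite set $S$ with a rank function $\mathrm{rk}:K\to\mathbb N$ whose $0$-cells are exactly the singletons of $S$, such that: (i) $x\subsetneq y$ implies $\mathrm{rk}(x)<\mathrm{rk}(y)$; (ii) the intersection of two cells is a cell or empty; (iii) if $x\subsetneq y$ are cells, there is a cell $z$ of rank $\mathrm{rk}(x)+1$ with $x\subset z\subset y$; (iv) if $x\subset y$ are cells with $\mathrm{rk}(y)=\mathrm{rk}(x)+2$, there are exactly two cells $z$ of rank $\mathrm{rk}(x)+1$ with $x\subset z\subset y$. Write $K^{[r]}$ for the set of $r$-cells, $K^{(k)}$ for the $k$-skeleton (cells of rank $\le k$), $K\cap A$ for the cc of cells contained in $A$. The rank of $K$ is the largest rank of a cell; an $R$-cc is a cc of rank $R$. A sub-cc is a subset of cells that is a cc for the restricted rank function. Vertices are $0$-cells and edges are $1$-cells. $K$ is *graph-based* if every edge has two vertices; then $\mathcal E_v$ is the set of edges containing the vertex $v$, and $K$ is $n$-regular if $|\mathcal E_v|=n$ for all $v$. $K$ is *local* if it is graph-based and the graph of vertices and edges of $K$, and of $K\cap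 x$ for every cell $x$, is connected. $K$ is *$r$-full* ($2\le r\le$ rank of $K$) if for every vertex $v$ and every $S\subset\mathcal E_v$ with $2\le|S|=k\le r$ there is a $k$-cell $x$ with $\{e\in\mathcal E_v: e\subset x\}=S$; *full* means $2$-full. An $R$-cc is *closed* if it is graph-based, all its maximal cells have rank $R$ and every $(R-1)$-cell lies in exactly two $R$-cells; it is *simple* if it is closed and, when $R\ge2$, $R$-full. $K$ is *even* if each connected component of each $2$-cell has an even number of vertices. For a full $K$ and an edge $\{v,w\}$, the *connection* $\nabla^v_w:\mathcal E_v\to\mathcal E_w$ fixes $\{v,w\}$ and sends any other $e\in\mathcal E_v$ to the edge $f\neq\{v,w\}$ at $w$ contained in the $2$-cell that contains $e$ and $\{v,w\}$; along a path one composes these maps. $K$ is *monodromy-free* if for each connected component $D$ of each $2$-cell, with $v\in D$, the connection along the loop around $D$ based at $v$ fixes every $e\in\mathcal E_v$ with $|e\cap D|=1$. A graph-based $K$ is *simply connected* if every closed edge path can be transformed into the empty path by finitely many moves of the following kinds: inserting or deleting a passage back and forth through an edge; replacing a sub-path running along a connected component $D$ of a $2$-cell by the complementary path in $D$. Let $K$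 be a local, even, full, monodromy-free, simply connected $2$-cc. An *$r$-regular induced sub-cc* of $K$ is an $r$-regular, local, even, full, monodromy-free sub-$2$-cc $J$ of $K$ such that $J^{[1]}\cap\mathcal E_v=S$ for some vertex $v$ and some $S\subsetneq\mathcal E_v$ with $|S|=r\ge2$. The set $\mathcal C^K_r$ of *induced $r$-cells* is the set of vertex sets of these $J$. It is *non-singular* if, for any two $r$-regular induced sub-cc's $J,J'$, the graph of common vertices and common edges of $J$ and $J'$ is connected or empty. **Theorem.** Let $K$ be a local, even, full, monodromy-free, simply connected $2$-cc. Suppose that $\mathcal C^K_r\neq\emptyset$ for some $r$, let $R$ be the largest such $r$, and suppose that $\mathcal C^K_r$ is non-singular for all $2\le r\le R$. Then there is a local, even, simply connected, simple $R$-cc $K_{amb}$ with $(K_{amb})^{(2)}=K$ (same cells, same ranks). -/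

import Mathlib

/-- A (combinatorial) cell complex `K` whose vertices lie in the type `V`.
The pair (set of cells, rank function) is recorded through the sets `cell r` of cells of rank `r`;
by `rank_unique` every cell has exactly one rank.  The vertex set `S` is the set of
`v` such that `{v}` is a `0`-cell; it is finite and every cell is a non-empty subset of it. -/
structure CellComplex (V : Type*) where
  cell : ℕ → Set (Set V)
  finite_vertices : {v : V | ({v} : Set V) ∈ cell 0}.Finite
  nonempty_of_mem : ∀ r x, x ∈ cell r → x.Nonempty
  rank_unique : ∀ r s x, x ∈ cell r → x ∈ cell s → r = s
  eq_singleton : ∀ x, x ∈ cell 0 → ∃ v : V, x = {v}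
  singleton_mem : ∀ r x, x ∈ cell r → ∀ v ∈ x, ({v} : Set V) ∈ cell 0
  rank_lt : ∀ r s x y, x ∈ cell r → y ∈ cell s → x ⊂ y → r < s
  inter_mem : ∀ r s x y, x ∈ cell r → y ∈ cell s → (x ∩ y).Nonempty → ∃ t, x ∩ y ∈ cell t
  exists_coface : ∀ r s x y, x ∈ cell r → y ∈ cell s → x ⊂ y →
    ∃ z ∈ cell (r + 1), x ⊆ z ∧ z ⊆ y
  diamond : ∀ r x y, x ∈ cell r → y ∈ cell (r + 2) → x ⊆ y →
    {z | z ∈ cell (r + 1) ∧ x ⊆ z ∧ z ⊆ y}.ncard = 2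

namespace CellComplex

variable {V : Type*}

/-- The vertex set of `K`. -/
def vertices (K : CellComplex V) : Set V := {v | ({v} : Set V) ∈ K.cell 0}

/-- `K` has rank (dimension) `R`: `R` is the least integer bounding the ranks of all cells. -/
def HasRank (K : CellComplex V) (R : ℕ) : Prop :=
  IsLeast {n : ℕ | ∀ r, (K.cell r).Nonempty → r ≤ n} R

/-- `J` is a sub-cell complex of `K`: its cells are cells of `K`, with the same rank. -/
def IsSub (J K : CellComplex V) : Prop := ∀ r, J.cell r ⊆ K.cell r

/-- The `k`-skeleton: all cells of rank at most `k`. -/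
def skeleton (K : CellComplex V) (k : ℕ) : CellComplex V where
  cell r := {x | r ≤ k ∧ x ∈ K.cell r}
  finite_vertices := K.finite_vertices.subset fun _ h => h.2
  nonempty_of_mem r x h := K.nonempty_of_mem r x h.2
  rank_unique r s x h h' := K.rank_unique r s x h.2 h'.2
  eq_singleton x h := K.eq_singleton x h.2
  singleton_mem r x h v hv := ⟨Nat.zero_le k, K.singleton_mem r x h.2 v hv⟩
  rank_lt r s x y h h' hxy := K.rank_lt r s x y h.2 h'.2 hxy
  inter_mem r s x y h h' hne := by
    obtain ⟨t, ht⟩ := K.inter_mem r s x y h.2 h'.2 hne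
    refine ⟨t, ?_, ht⟩
    rcases eq_or_ne (x ∩ y) x with he | he
    · rw [he] at ht
      rw [K.rank_unique t r x ht h.2]
      exact h.1
    · exact ((K.rank_lt t r (x ∩ y) x ht h.2
        (LE.le.ssubset_of_ne Set.inter_subset_left he)).le).trans h.1
  exists_coface r s x y h h' hxy := by
    obtain ⟨z, hz, hxz, hzy⟩ := K.exists_coface r s x y h.2 h'.2 hxy
    have hrs : r < s := K.rank_lt r s x y h.2 h'.2 hxy
    exact ⟨z, ⟨le_trans hrs h'.1, hz⟩, hxz, hzy⟩
  diamond r x y h h' hxy := by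
    have hk : r + 1 ≤ k := le_trans (Nat.le_succ (r + 1)) h'.1
    rw [← K.diamond r x y h.2 h'.2 hxy]
    congr 1
    ext z
    simp [hk]

/-- The restriction `K ∩ A`: all cells of `K` contained in `A`. -/
def restrict (K : CellComplex V) (A : Set V) : CellComplex V where
  cell r := {x | x ∈ K.cell r ∧ x ⊆ A}
  finite_vertices := K.finite_vertices.subset fun _ h => h.1
  nonempty_of_mem r x h := K.nonempty_of_mem r x h.1
  rank_unique r s x h h' := K.rank_unique r s x h.1 h'.1
  eq_singleton x h := K.eq_singleton x h.1
  singleton_mem r x h v hv :=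
    ⟨K.singleton_mem r x h.1 v hv, Set.singleton_subset_iff.2 (h.2 hv)⟩
  rank_lt r s x y h h' hxy := K.rank_lt r s x y h.1 h'.1 hxy
  inter_mem r s x y h h' hne := by
    obtain ⟨t, ht⟩ := K.inter_mem r s x y h.1 h'.1 hne
    exact ⟨t, ht, Set.inter_subset_left.trans h.2⟩
  exists_coface r s x y h h' hxy := by
    obtain ⟨z, hz, hxz, hzy⟩ := K.exists_coface r s x y h.1 h'.1 hxy
    exact ⟨z, ⟨hz, hzy.trans h'.2⟩, hxz, hzy⟩
  diamond r x y h h' hxy := by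
    rw [← K.diamond r x y h.1 h'.1 hxy]
    congr 1
    ext z
    constructor
    · rintro ⟨hz, hxz, hzy⟩
      exact ⟨hz.1, hxz, hzy⟩
    · rintro ⟨hz, hxz, hzy⟩
      exact ⟨⟨hz, hzy.trans h'.2⟩, hxz, hzy⟩

/-- Every edge has exactly two vertices. -/
def IsGraphBased (K : CellComplex V) : Prop := ∀ e ∈ K.cell 1, e.ncard = 2

/-- The graph formed by the vertices and the two-point edges of `K` (the `1`-skeleton if `K` is
graph-based). Points of `V` that are not vertices of `K` are isolated. -/
def graph (K : CellComplex V) : SimpleGraph V where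
  Adj v w := v ≠ w ∧ ({v, w} : Set V) ∈ K.cell 1
  symm := ⟨fun v w h => ⟨h.1.symm, by rw [Set.pair_comm]; exact h.2⟩⟩
  loopless := ⟨fun _ h => h.1 rfl⟩

/-- Connected: graph-based, and any two vertices are linked by a path. -/
def IsConnected (K : CellComplex V) : Prop :=
  K.IsGraphBased ∧ ∀ v ∈ K.vertices, ∀ w ∈ K.vertices, K.graph.Reachable v w

/-- Cell-connected: graph-based, and `K ∩ x` is connected for every cell `x`. -/
def IsCellConnected (K : CellComplex V) : Prop :=
  K.IsGraphBased ∧ ∀ r, ∀ x ∈ K.cell r, (K.restrict x).IsConnected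

/-- A local cell complex of rank `R`. -/
def IsLocal (K : CellComplex V) (R : ℕ) : Prop :=
  K.HasRank R ∧ K.IsConnected ∧ K.IsCellConnected

/-- The set of edges incident to `v`. -/
def edgesAt (K : CellComplex V) (v : V) : Set (Set V) := {e | e ∈ K.cell 1 ∧ v ∈ e}

/-- The set of edges incident to `v` and contained in `x`. -/
def edgesAtIn (K : CellComplex V) (v : V) (x : Set V) : Set (Set V) :=
  {e | e ∈ K.edgesAt v ∧ e ⊆ x}

/-- `n`-regular: graph-based, and every vertex is incident to exactly `n` edges. -/
def IsRegular (K : CellComplex V) (n : ℕ) : Prop :=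
  K.IsGraphBased ∧ ∀ v ∈ K.vertices, (K.edgesAt v).ncard = n

/-- `r`-full (for `2 ≤ r ≤` the rank of `K`): every set of `k` edges at a vertex `v`, `2 ≤ k ≤ r`,
is the set of edges at `v` of some `k`-cell. -/
def IsFull (K : CellComplex V) (r : ℕ) : Prop :=
  (∃ R, K.HasRank R ∧ 2 ≤ r ∧ r ≤ R) ∧
    ∀ v ∈ K.vertices, ∀ k, 2 ≤ k → k ≤ r → ∀ S ⊆ K.edgesAt v, S.ncard = k →
      ∃ x ∈ K.cell k, K.edgesAtIn v x = S

/-- Pure of rank `R`: every maximal cell has rank `R`. -/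
def IsPure (K : CellComplex V) (R : ℕ) : Prop :=
  K.HasRank R ∧ ∀ r, ∀ x ∈ K.cell r, (∀ s, ∀ y ∈ K.cell s, ¬ x ⊂ y) → r = R

/-- Closed, of rank `R`: graph-based, pure, and every `(R-1)`-cell is contained in exactly two
`R`-cells. -/
def IsClosed (K : CellComplex V) (R : ℕ) : Prop :=
  K.IsGraphBased ∧ K.IsPure R ∧
    ∀ s, s + 1 = R → ∀ y ∈ K.cell s, {z | z ∈ K.cell R ∧ y ⊆ z}.ncard = 2

/-- Simple, of rank `R`: closed and, if `R ≥ 2`, `R`-full. -/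
def IsSimple (K : CellComplex V) (R : ℕ) : Prop :=
  K.IsClosed R ∧ (2 ≤ R → K.IsFull R)

/-- `D` is (the vertex set of) a connected component of a `2`-cell `C` of `K`. -/
def IsTwoCellComponent (K : CellComplex V) (D : Set V) : Prop :=
  ∃ C ∈ K.cell 2, ∃ v ∈ C, D = {w | w ∈ C ∧ (K.restrict C).graph.Reachable v w}

/-- Even: every connected component of every `2`-cell has an even number of vertices. -/
def IsEven (K : CellComplex V) : Prop := ∀ D, K.IsTwoCellComponent D → Even D.ncard

/-- `l` is one of the two loops (one for each orientation) based at `v` that run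
once around the connected component `D` of a `2`-cell. -/
def IsLoopAround (K : CellComplex V) (D : Set V) {v : V} (l : K.graph.Walk v v) : Prop :=
  l.IsCycle ∧ {w | w ∈ l.support} = D

/-- The graph of the connection from `v` to a neighbour `w`: `K.Nabla v w e f` says that the
connection maps the edge `e` at `v` to the edge `f` at `w`. The edge `{v, w}` is mapped to itself,
and any other `e` is mapped to the edge `f ≠ {v, w}` at `w` lying in the `2`-cell
that contains `e` and `{v, w}`. -/
def Nabla (K : CellComplex V) (v w : V) (e f : Set V) : Prop :=
  e ∈ K.edgesAt v ∧ f ∈ K.edgesAt w ∧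
    ((e = {v, w} ∧ f = {v, w}) ∨
      (e ≠ {v, w} ∧ f ≠ {v, w} ∧ ∃ C ∈ K.cell 2, {v, w} ⊆ C ∧ e ⊆ C ∧ f ⊆ C))

/-- The graph of the connection along a path: `K.NablaPath p e f` says that it maps `e` to `f`. -/
def NablaPath (K : CellComplex V) {v w : V} (p : K.graph.Walk v w) (e f : Set V) : Prop :=
  match p with
  | .nil => e = f
  | .cons (v := u) _ q => ∃ g, K.Nabla v u e g ∧ K.NablaPath q g f

/-- Monodromy-free: around every connected component `D` of every `2`-cell, the connection along
the loop around `D` (based at some `v ∈ D`) fixes every edge at `v` meeting `D` only in `v`. -/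
def IsMonodromyFree (K : CellComplex V) : Prop :=
  ∀ D, K.IsTwoCellComponent D → ∃ v ∈ D, ∃ l : K.graph.Walk v v, K.IsLoopAround D l ∧
    ∀ e ∈ K.edgesAt v, (e ∩ D).ncard = 1 → K.NablaPath l e e

/-- The elementary moves of paths: a path `p` along a connected component `D` of a `2`-cell is
replaced by the complementary path `p'` in `D` (so `p` followed by the inverse of `p'` is a
loop around `D`), or a back-and-forth passage through an edge is deleted. -/
inductive Move (K : CellComplex V) : {v w : V} → K.graph.Walk v w → K.graph.Walk v w → Prop
  | cell {v a b w : V} (q₁ : K.graph.Walk v a) (p p' : K.graph.Walk a b) (q₂ : K.graph.Walk b w)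
      (D : Set V) (hD : K.IsTwoCellComponent D) (hl : K.IsLoopAround D (p.append p'.reverse)) :
      K.Move ((q₁.append p).append q₂) ((q₁.append p').append q₂)
  | edge {v a b w : V} (q₁ : K.graph.Walk v a) (h : K.graph.Adj a b) (q₂ : K.graph.Walk a w) :
      K.Move (q₁.append (.cons h (.cons h.symm q₂))) (q₁.append q₂)

/-- Homotopy of paths: finitely many moves and inverse moves. -/
def Homotopic (K : CellComplex V) {v w : V} (p q : K.graph.Walk v w) : Prop :=
  Relation.EqvGen (fun a b => K.Move a b) p q

/-- Simply connected: graph-based, and every cycle (closed path) is contractible. Only the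
edges and `2`-cells, that is the `2`-skeleton, are involved. -/
def IsSimplyConnected (K : CellComplex V) : Prop :=
  K.IsGraphBased ∧ ∀ v ∈ K.vertices, ∀ p : K.graph.Walk v v, K.Homotopic p .nil

/-- `J` is an `r`-regular induced sub-cell complex of the `2`-cell complex `K`: for some vertex `v`
and some proper subset `S` of the edges at `v` with `r = |S| ≥ 2`, `J` is an `r`-regular local even
full monodromy-free sub-`2`-cell complex whose set of edges at `v` is `S`. -/
def IsInducedSub (K : CellComplex V) (r : ℕ) (J : CellComplex V) : Prop :=
  ∃ v ∈ K.vertices, ∃ S ⊂ K.edgesAt v, 2 ≤ r ∧ S.ncard = r ∧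
    J.IsSub K ∧ J.IsRegular r ∧ J.IsLocal 2 ∧ J.IsEven ∧ J.IsFull 2 ∧ J.IsMonodromyFree ∧
    J.cell 1 ∩ K.edgesAt v = S

/-- The set of induced `r`-cells: the vertex sets of the `r`-regular induced sub-cell complexes. -/
def inducedCells (K : CellComplex V) (r : ℕ) : Set (Set V) :=
  {x | ∃ J : CellComplex V, K.IsInducedSub r J ∧ J.vertices = x}

/-- The collection of induced `r`-cells is non-singular: any two of them
intersect, as sub-complexes, in a complex that is connected or empty. Here `J.graph ⊓ J'.graph`
consists of the edges common to `J` and `J'`. -/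
def NonsingularInducedCells (K : CellComplex V) (r : ℕ) : Prop :=
  ∀ J J' : CellComplex V, K.IsInducedSub r J → K.IsInducedSub r J' →
    ∀ v ∈ J.vertices ∩ J'.vertices, ∀ w ∈ J.vertices ∩ J'.vertices,
      (J.graph ⊓ J'.graph).Reachable v w

end CellComplex

/-! The connection turns `K` into an edge-coloured graph, and the cells of the ambient complex are
colour components.

Around a 2-cell, transport fixes the edges sticking out of it by monodromy-freeness, and its own two
edges at a vertex by evenness, since transport alternates between fixing an edge of the cell and
passing to the next one (`IsLoopAround.nablaPath_self`). Hence transport is invariant under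
homotopy, and simple connectedness makes it independent of the path. Labelling each edge by the edge
at a base vertex that is carried to it gives a parallel colouring in which every colour occurs
exactly once at each vertex (`exists_edgeColoring`).

For a set `S` of colours, `comp S v` is the component of `v` in the graph of edges coloured in `S`.
The 2-cells are exactly the components for two colours, and each proper `S` with at least two
colours yields an induced sub-complex (`isInducedSub_sub`). So there are `R + 1` colours, and
non-singularity gives `comp S v ∩ comp T v = comp (S ∩ T) v` (`reachable_inter`). Consequently the
components through `v` are ordered like the subsets of the colour set. Taking those with at most `R`
colours as cells, the axioms, fullness and closedness become statements about finite sets, while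
evenness and simple connectedness only see the 2-skeleton, which is `K`. -/

namespace CellComplex

variable {V : Type*} {K : CellComplex V}

/-! ### Edges and 2-cells at a vertex. -/

theorem eq_of_subset {r : ℕ} {x y : Set V} (hx : x ∈ K.cell r) (hy : y ∈ K.cell r)
    (h : x ⊆ y) : x = y := by
  by_contra hne
  exact (K.rank_lt r r x y hx hy (h.ssubset_of_ne hne)).false

theorem mem_vertices_of_mem {r : ℕ} {x : Set V} (hx : x ∈ K.cell r) {v : V} (hv : v ∈ x) :
    v ∈ K.vertices := K.singleton_mem r x hx v hv

theorem graph_adj {v w : V} : K.graph.Adj v w ↔ v ≠ w ∧ ({v, w} : Set V) ∈ K.cell 1 := Iff.rfl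

theorem Adj.mem_edgesAt_left {v w : V} (h : K.graph.Adj v w) :
    ({v, w} : Set V) ∈ K.edgesAt v := ⟨h.2, by simp⟩

theorem Adj.mem_edgesAt_right {v w : V} (h : K.graph.Adj v w) :
    ({v, w} : Set V) ∈ K.edgesAt w := ⟨h.2, by simp⟩

theorem Adj.mem_vertices {v w : V} (h : K.graph.Adj v w) : v ∈ K.vertices :=
  mem_vertices_of_mem h.2 (by simp)

theorem pair_left_injective {a b c : V} (h : ({a, b} : Set V) = {a, c}) : b = c := by
  have h1 : b ∈ ({a, c} : Set V) := h ▸ (by simp)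
  have h2 : c ∈ ({a, b} : Set V) := h ▸ (by simp)
  simp only [Set.mem_insert_iff, Set.mem_singleton_iff] at h1 h2
  grind

/-- In a graph-based cell complex every edge at `v` joins `v` to a neighbour. -/
theorem IsGraphBased.exists_adj (hg : K.IsGraphBased) {v : V} {e : Set V} (he : e ∈ K.edgesAt v) :
    ∃ w, K.graph.Adj v w ∧ e = {v, w} := by
  obtain ⟨a, b, hab, rfl⟩ := Set.ncard_eq_two.1 (hg e he.1)
  have hv := he.2
  simp only [Set.mem_insert_iff, Set.mem_singleton_iff] at hv
  rcases hv with rfl | rfl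
  · exact ⟨b, ⟨hab, he.1⟩, rfl⟩
  · exact ⟨a, ⟨hab.symm, Set.pair_comm a v ▸ he.1⟩, Set.pair_comm a v⟩

/-- This is the diamond axiom between `{v}` and `X`. -/
theorem ncard_edgesAtIn {v : V} {X : Set V} (hX : X ∈ K.cell 2) (hv : v ∈ X) :
    (K.edgesAtIn v X).ncard = 2 := by
  rw [← K.diamond 0 {v} X (mem_vertices_of_mem hX hv) hX (by simpa using hv)]
  congr 1
  ext z
  simp only [edgesAtIn, edgesAt, Set.mem_ofPred_eq, Set.singleton_subset_iff]
  tauto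

theorem eq_or_eq_of_mem_edgesAtIn {v : V} {X e f g : Set V} (hX : X ∈ K.cell 2)
    (he : e ∈ K.edgesAtIn v X) (hf : f ∈ K.edgesAtIn v X) (hef : e ≠ f)
    (hg : g ∈ K.edgesAtIn v X) : g = e ∨ g = f := by
  obtain ⟨a, b, hab, h⟩ := Set.ncard_eq_two.1 (ncard_edgesAtIn hX (he.2 he.1.2))
  rw [h] at he hf hg
  simp only [Set.mem_insert_iff, Set.mem_singleton_iff] at he hf hg
  grind

theorem exists_other_edge {v : V} {X e : Set V} (hX : X ∈ K.cell 2)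
    (he : e ∈ K.edgesAtIn v X) : ∃ f ∈ K.edgesAtIn v X, f ≠ e := by
  obtain ⟨a, b, hab, h⟩ := Set.ncard_eq_two.1 (ncard_edgesAtIn hX (he.2 he.1.2))
  rw [h] at he ⊢
  simp only [Set.mem_insert_iff, Set.mem_singleton_iff] at he
  rcases he with rfl | rfl
  · exact ⟨b, by simp, hab.symm⟩
  · exact ⟨a, by simp, hab⟩

/-- A `2`-cell is determined by two of its edges with a common vertex. -/
theorem twoCell_unique {v : V} {X Y e f : Set V} (hX : X ∈ K.cell 2) (hY : Y ∈ K.cell 2)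
    (he : e ∈ K.edgesAt v) (hf : f ∈ K.edgesAt v) (hef : e ≠ f) (heX : e ⊆ X) (hfX : f ⊆ X)
    (heY : e ⊆ Y) (hfY : f ⊆ Y) : X = Y := by
  obtain ⟨t, ht⟩ := K.inter_mem 2 2 X Y hX hY ⟨v, heX he.2, heY he.2⟩
  -- Containing two distinct edges, `X ∩ Y` is not an edge, so its rank exceeds 1; a proper face of
  -- `X` would have rank below 2.
  have hne : e ≠ X ∩ Y := by
    intro h
    exact hef (eq_of_subset hf.1 he.1 (h ▸ Set.subset_inter hfX hfY)).symm
  have h1 := K.rank_lt 1 t e (X ∩ Y) he.1 ht ((Set.subset_inter heX heY).ssubset_of_ne hne)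
  by_cases h : X ∩ Y = X
  · exact eq_of_subset hX hY (Set.inter_eq_left.1 h)
  · have := K.rank_lt t 2 (X ∩ Y) X ht hX (Set.inter_subset_left.ssubset_of_ne h)
    omega

theorem IsFull.exists_twoCell (hfull : K.IsFull 2) {v : V} {e f : Set V} (he : e ∈ K.edgesAt v)
    (hf : f ∈ K.edgesAt v) (hef : e ≠ f) :
    ∃ X ∈ K.cell 2, K.edgesAtIn v X = {e, f} ∧ e ⊆ X ∧ f ⊆ X := by
  obtain ⟨X, hX, h⟩ := hfull.2 v (mem_vertices_of_mem he.1 he.2) 2 le_rfl le_rfl {e, f}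
    (by rintro g (rfl | rfl) <;> assumption) (Set.ncard_pair hef)
  have h1 : e ∈ K.edgesAtIn v X := by rw [h]; simp
  have h2 : f ∈ K.edgesAtIn v X := by rw [h]; simp
  exact ⟨X, hX, h, h1.2, h2.2⟩

/-! ### The connection along an edge -/

theorem Nabla.symm {v w : V} {e f : Set V} (h : K.Nabla v w e f) : K.Nabla w v f e := by
  obtain ⟨he, hf, h⟩ := h
  refine ⟨hf, he, ?_⟩
  rw [Set.pair_comm w v]
  rcases h with ⟨h1, h2⟩ | ⟨h1, h2, C, hC, h3, h4, h5⟩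
  · exact Or.inl ⟨h2, h1⟩
  · exact Or.inr ⟨h2, h1, C, hC, h3, h5, h4⟩

theorem Nabla.pair {v w : V} (h : K.graph.Adj v w) : K.Nabla v w {v, w} {v, w} :=
  ⟨Adj.mem_edgesAt_left h, Adj.mem_edgesAt_right h, Or.inl ⟨rfl, rfl⟩⟩

/-- Two edges at `v` determine the 2-cell, and that cell has a single further edge at `w`. With
`Nabla.symm` and `Nabla.exists`, the relation is a bijection between the edges at `v` and at `w`
when `K` is full. -/
theorem Nabla.unique {v w : V} {e f f' : Set V} (hvw : K.graph.Adj v w) (h : K.Nabla v w e f)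
    (h' : K.Nabla v w e f') : f = f' := by
  obtain ⟨he, hf, h⟩ := h
  obtain ⟨-, hf', h'⟩ := h'
  rcases h with ⟨h1, h2⟩ | ⟨h1, h2, C, hC, h3, h4, h5⟩ <;>
    rcases h' with ⟨h1', h2'⟩ | ⟨h1', h2', C', hC', h3', h4', h5'⟩
  · rw [h2, h2']
  · exact absurd h1 h1'
  · exact absurd h1' h1
  · obtain rfl := twoCell_unique hC hC' he (Adj.mem_edgesAt_left hvw) h1 h4 h3 h4' h3'
    have := eq_or_eq_of_mem_edgesAtIn hC ⟨Adj.mem_edgesAt_right hvw, h3⟩ ⟨hf, h5⟩ h2.symm ⟨hf', h5'⟩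
    exact (this.resolve_left h2').symm

theorem Nabla.exists (hfull : K.IsFull 2) {v w : V} {e : Set V} (hvw : K.graph.Adj v w)
    (he : e ∈ K.edgesAt v) : ∃ f, K.Nabla v w e f := by
  by_cases h : e = {v, w}
  · exact ⟨{v, w}, h ▸ Nabla.pair hvw⟩
  · obtain ⟨X, hX, -, h1, h2⟩ := hfull.exists_twoCell he (Adj.mem_edgesAt_left hvw) h
    obtain ⟨f, hf, hne⟩ := exists_other_edge hX ⟨Adj.mem_edgesAt_right hvw, h2⟩
    exact ⟨f, he, hf.1, Or.inr ⟨h, hne, X, hX, h2, h1, hf.2⟩⟩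

/-! ### The connection along a path -/

@[simp]
theorem nablaPath_nil {v : V} {e f : Set V} :
    K.NablaPath (.nil : K.graph.Walk v v) e f ↔ e = f := Iff.rfl

@[simp]
theorem nablaPath_cons {u v w : V} (h : K.graph.Adj u v) (p : K.graph.Walk v w) {e f : Set V} :
    K.NablaPath (.cons h p) e f ↔ ∃ g, K.Nabla u v e g ∧ K.NablaPath p g f := Iff.rfl

theorem nablaPath_append {u v w : V} (p : K.graph.Walk u v) (q : K.graph.Walk v w) {e f : Set V} :
    K.NablaPath (p.append q) e f ↔ ∃ g, K.NablaPath p e g ∧ K.NablaPath q g f := by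
  induction p generalizing e with
  | nil => simp
  | cons h p ih =>
    simp only [SimpleGraph.Walk.cons_append, nablaPath_cons, ih]
    constructor
    · rintro ⟨g, h1, g', h2, h3⟩
      exact ⟨g', ⟨g, h1, h2⟩, h3⟩
    · rintro ⟨g', ⟨g, h1, h2⟩, h3⟩
      exact ⟨g, h1, g', h2, h3⟩

theorem NablaPath.reverse {u v : V} {p : K.graph.Walk u v} {e f : Set V}
    (h : K.NablaPath p e f) : K.NablaPath p.reverse f e := by
  induction p generalizing e with
  | nil => exact Eq.symm h
  | cons h' p ih =>
    obtain ⟨g, h1, h2⟩ := h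
    rw [SimpleGraph.Walk.reverse_cons, nablaPath_append]
    exact ⟨g, ih h2, e, h1.symm, rfl⟩

theorem nablaPath_reverse {u v : V} {p : K.graph.Walk u v} {e f : Set V} :
    K.NablaPath p.reverse f e ↔ K.NablaPath p e f :=
  ⟨fun h => by simpa using h.reverse, NablaPath.reverse⟩

theorem NablaPath.unique {u v : V} {p : K.graph.Walk u v} {e f f' : Set V}
    (h : K.NablaPath p e f) (h' : K.NablaPath p e f') : f = f' := by
  induction p generalizing e with
  | nil => exact h.symm.trans h'
  | cons hadj p ih =>
    obtain ⟨g, h1, h2⟩ := h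
    obtain ⟨g', h1', h2'⟩ := h'
    obtain rfl := Nabla.unique hadj h1 h1'
    exact ih h2 h2'

theorem NablaPath.exists (hfull : K.IsFull 2) {u v : V} (p : K.graph.Walk u v) {e : Set V}
    (he : e ∈ K.edgesAt u) : ∃ f ∈ K.edgesAt v, K.NablaPath p e f := by
  induction p generalizing e with
  | nil => exact ⟨e, he, rfl⟩
  | cons hadj p ih =>
    obtain ⟨g, hg⟩ := Nabla.exists hfull hadj he
    obtain ⟨f, hf, h⟩ := ih hg.2.1
    exact ⟨f, hf, g, hg, h⟩

theorem NablaPath.mem_edgesAt {u v : V} {p : K.graph.Walk u v} {e f : Set V}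
    (h : K.NablaPath p e f) (he : e ∈ K.edgesAt u) : f ∈ K.edgesAt v := by
  induction p generalizing e with
  | nil => exact h ▸ he
  | cons hadj p ih =>
    obtain ⟨g, h1, h2⟩ := h
    exact ih h2 h1.2.1

/-- The indexed form allows transport around a cycle to be described by the parity or position of a
vertex on it. -/
theorem nablaPath_iff_seq {u v : V} (p : K.graph.Walk u v) {e f : Set V} :
    K.NablaPath p e f ↔ ∃ t : ℕ → Set V, t 0 = e ∧ t p.length = f ∧
      ∀ i < p.length, K.Nabla (p.getVert i) (p.getVert (i + 1)) (t i) (t (i + 1)) := by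
  induction p generalizing e with
  | nil =>
    constructor
    · intro h
      exact ⟨fun _ => e, rfl, h, by simp⟩
    · rintro ⟨t, h1, h2, -⟩
      exact h1.symm.trans h2
  | cons hadj p ih =>
    simp only [nablaPath_cons, ih]
    constructor
    · rintro ⟨g, h1, t, h2, h3, h4⟩
      refine ⟨fun i => Nat.casesOn i e t, rfl, by rw [SimpleGraph.Walk.length_cons]; exact h3, ?_⟩
      rintro (_ | i) hi
      · simpa [h2] using h1
      · simpa using h4 i (by simpa using hi)
    · rintro ⟨t, h1, h2, h3⟩
      refine ⟨t 1, ?_, fun i => t (i + 1), rfl, by simpa using h2, fun i hi => ?_⟩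
      · simpa [h1] using h3 0 (by simp)
      · simpa using h3 (i + 1) (by simpa using hi)

/-! ### The connection around a `2`-cell -/

theorem IsLoopAround.getVert_mem {D : Set V} {v : V} {l : K.graph.Walk v v}
    (hl : K.IsLoopAround D l) (i : ℕ) : l.getVert i ∈ D := by
  rw [← hl.2]
  exact l.getVert_mem_support i

theorem IsLoopAround.reverse {D : Set V} {v : V} {l : K.graph.Walk v v}
    (hl : K.IsLoopAround D l) : K.IsLoopAround D l.reverse :=
  ⟨hl.1.reverse, by simpa using hl.2⟩

theorem IsLoopAround.ncard_eq {D : Set V} {v : V} {l : K.graph.Walk v v}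
    (hl : K.IsLoopAround D l) : D.ncard = l.length := by
  have h : D = l.getVert '' Set.Ico 0 l.length := by
    ext w
    rw [← hl.2]
    simp only [Set.mem_ofPred_eq, SimpleGraph.Walk.mem_support_iff_exists_getVert, Set.mem_image,
      Set.mem_Ico]
    constructor
    · rintro ⟨n, rfl, hn⟩
      rcases hn.lt_or_eq with hn | rfl
      · exact ⟨n, ⟨by omega, hn⟩, rfl⟩
      · exact ⟨0, ⟨le_rfl, by have := hl.1.three_le_length; omega⟩, by simp⟩
    · rintro ⟨n, hn, rfl⟩
      exact ⟨n, rfl, hn.2.le⟩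
  rw [h, Set.InjOn.ncard_image]
  · simp [Set.ncard_eq_toFinset_card']
  · intro i hi j hj hij
    have h3 := hl.1.three_le_length
    exact hl.1.getVert_injOn' (by simp only [Set.mem_Ico, Set.mem_ofPred_eq] at *; omega)
      (by simp only [Set.mem_Ico, Set.mem_ofPred_eq] at *; omega) hij

/-- Two neighbours in a `2`-cell are consecutive on every loop around it. -/
theorem IsLoopAround.exists_getVert {X : Set V} (hX : X ∈ K.cell 2) {v a b : V}
    {l : K.graph.Walk v v} (hl : K.IsLoopAround X l) (ha : a ∈ X) (hb : b ∈ X)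
    (hab : K.graph.Adj a b) :
    ∃ i < l.length, (l.getVert i = a ∧ l.getVert (i + 1) = b) ∨
      (l.getVert i = b ∧ l.getVert (i + 1) = a) := by
  have ha' : a ∈ l.support := by rw [← hl.2] at ha; exact ha
  obtain ⟨c, d, hcd, h⟩ := Set.ncard_eq_two.1 (hl.1.ncard_neighborSet_toSubgraph_eq_two ha')
  have key : ∀ w, l.toSubgraph.Adj a w → ({a, w} : Set V) ∈ K.edgesAtIn a X := by
    intro w hw
    have hw' : w ∈ X := by
      rw [← hl.2]
      exact SimpleGraph.Walk.mem_support_of_adj_toSubgraph hw.symm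
    refine ⟨Adj.mem_edgesAt_left hw.adj_sub, ?_⟩
    rintro x (rfl | rfl) <;> assumption
  have hc : l.toSubgraph.Adj a c := by
    have : c ∈ l.toSubgraph.neighborSet a := by rw [h]; simp
    exact this
  have hd : l.toSubgraph.Adj a d := by
    have : d ∈ l.toSubgraph.neighborSet a := by rw [h]; simp
    exact this
  -- The cell has only two edges at `a`, and the loop already runs through both.
  have hb' := eq_or_eq_of_mem_edgesAtIn hX (key c hc) (key d hd)
    (fun h => hcd (pair_left_injective h)) (g := {a, b})
    ⟨Adj.mem_edgesAt_left hab, by rintro x (rfl | rfl) <;> assumption⟩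
  have hab' : l.toSubgraph.Adj a b := by
    rcases hb' with hb' | hb'
    · rwa [pair_left_injective hb']
    · rwa [pair_left_injective hb']
  obtain ⟨i, hi, hlt⟩ := l.toSubgraph_adj_iff.1 hab'
  refine ⟨i, hlt, ?_⟩
  simpa [Sym2.eq_iff] using hi

/-- A section over `D` that is parallel for the connection. -/
def IsParallel (K : CellComplex V) (D : Set V) (s : V → Set V) : Prop :=
  ∀ a ∈ D, ∀ b ∈ D, K.graph.Adj a b → K.Nabla a b (s a) (s b)

/-- With a parallel section at hand, base point and orientation of a loop become irrelevant, so no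
walk needs to be rotated. -/
theorem IsParallel.nablaPath {D : Set V} {s : V → Set V} (hs : K.IsParallel D s) {u v : V}
    (p : K.graph.Walk u v) (hp : ∀ w ∈ p.support, w ∈ D) : K.NablaPath p (s u) (s v) := by
  induction p with
  | nil => exact rfl
  | cons h p ih =>
    simp only [SimpleGraph.Walk.support_cons, List.mem_cons, forall_eq_or_imp] at hp
    exact ⟨_, hs _ hp.1 _ (hp.2 _ p.start_mem_support) h, ih hp.2⟩

/-- An edge fixed by the connection along a loop around a `2`-cell extends to a parallel section. -/
theorem IsLoopAround.exists_isParallel {X : Set V} (hX : X ∈ K.cell 2) {v : V}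
    {l : K.graph.Walk v v} (hl : K.IsLoopAround X l) {e : Set V} (he : K.NablaPath l e e) :
    ∃ s, K.IsParallel X s ∧ s v = e := by
  classical
  obtain ⟨t, h0, hlen, ht⟩ := (nablaPath_iff_seq l).1 he
  have h3 := hl.1.three_le_length
  have hinj : ∀ i j, i < l.length → j < l.length → l.getVert i = l.getVert j → i = j :=
    fun i j hi hj hij => hl.1.getVert_injOn' (by simp only [Set.mem_ofPred_eq]; omega)
      (by simp only [Set.mem_ofPred_eq]; omega) hij
  -- Only indices below the length are used, so the base vertex gets index 0; closing up is
  -- consistent because `t` starts and ends at `e`. The default is never read on `X`.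
  let s : V → Set V := fun u => if h : ∃ i < l.length, l.getVert i = u then t h.choose else ∅
  have hs : ∀ i ≤ l.length, s (l.getVert i) = t i := by
    have hlt : ∀ i < l.length, s (l.getVert i) = t i := by
      intro i hi
      have h : ∃ j < l.length, l.getVert j = l.getVert i := ⟨i, hi, rfl⟩
      simp only [s, dif_pos h]
      rw [hinj _ _ h.choose_spec.1 hi h.choose_spec.2]
    intro i hi
    rcases hi.lt_or_eq with hi | rfl
    · exact hlt i hi
    · have := hlt 0 (by omega)
      rw [SimpleGraph.Walk.getVert_zero] at this
      rw [SimpleGraph.Walk.getVert_length, this, h0, hlen]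
  refine ⟨s, ?_, ?_⟩
  · intro a ha b hb hab
    obtain ⟨i, hi, ⟨rfl, rfl⟩ | ⟨rfl, rfl⟩⟩ := hl.exists_getVert hX ha hb hab
    · rw [hs i hi.le, hs (i + 1) hi]
      exact ht i hi
    · rw [hs i hi.le, hs (i + 1) hi]
      exact (ht i hi).symm
  · have := hs 0 (by omega)
    rwa [SimpleGraph.Walk.getVert_zero, h0] at this

/-- Around an even `2`-cell, the connection fixes the first edge of a loop. -/
theorem IsLoopAround.nablaPath_first {X : Set V} (hX : X ∈ K.cell 2) {v : V}
    {l : K.graph.Walk v v} (hl : K.IsLoopAround X l) (heven : Even X.ncard) :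
    K.NablaPath l {v, l.getVert 1} {v, l.getVert 1} := by
  rw [hl.ncard_eq] at heven
  have h3 := hl.1.three_le_length
  obtain ⟨m, hm⟩ := heven
  have hadj : ∀ i < l.length, K.graph.Adj (l.getVert i) (l.getVert (i + 1)) :=
    fun i hi => l.adj_getVert_succ hi
  have hsub : ∀ i j, ({l.getVert i, l.getVert j} : Set V) ⊆ X := by
    rintro i j x (rfl | rfl) <;> exact hl.getVert_mem _
  have hinj : ∀ i j, i < l.length → j < l.length → l.getVert i = l.getVert j → i = j :=
    fun i j hi hj hij => hl.1.getVert_injOn' (by simp only [Set.mem_ofPred_eq]; omega)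
      (by simp only [Set.mem_ofPred_eq]; omega) hij
  let E : ℕ → Set V := fun i => {l.getVert i, l.getVert (i + 1)}
  -- From an even index the edge `E i` is traversed and stays fixed; from an odd index transport
  -- passes to the next edge of the cell. Index `l.length` is set apart because `getVert` is
  -- constant past the end, which makes `E l.length` degenerate. Evenness of the length ensures that
  -- the last step starts at an odd index and lands on `E 0`.
  let t : ℕ → Set V := fun i => if i = l.length then E 0 else if Even i then E i else E (i - 1)
  refine (nablaPath_iff_seq l).2 ⟨t, ?_, ?_, fun i hi => ?_⟩
  · simp only [t, E]
    rw [if_neg (by omega), if_pos Even.zero]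
    simp
  · simp [t, E]
  · rcases Nat.even_or_odd i with he | ho
    · have h1 : ¬ Even (i + 1) := by
        intro h
        obtain ⟨a, ha⟩ := he
        obtain ⟨b, hb⟩ := h
        omega
      have h2 : i + 1 ≠ l.length := by
        rintro h
        exact h1 ⟨m, by omega⟩
      have ht1 : t i = E i := by simp only [t]; rw [if_neg hi.ne, if_pos he]
      have ht2 : t (i + 1) = E i := by
        simp only [t]; rw [if_neg h2, if_neg h1, Nat.add_sub_cancel]
      rw [ht1, ht2]
      exact Nabla.pair (hadj i hi)
    · obtain ⟨k, rfl⟩ := ho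
      have ht1 : t (2 * k + 1) = E (2 * k) := by
        simp only [t]
        rw [if_neg hi.ne, if_neg (by rw [Nat.not_even_iff_odd]; exact ⟨k, rfl⟩), Nat.add_sub_cancel]
      rw [ht1]
      have hne : E (2 * k) ≠ {l.getVert (2 * k + 1), l.getVert (2 * k + 1 + 1)} := by
        intro h
        simp only [E] at h
        rw [Set.pair_comm] at h
        exact hl.1.getVert_sub_one_ne_getVert_add_one hi.le (pair_left_injective h)
      by_cases hlast : 2 * k + 1 + 1 = l.length
      · have ht2 : t (2 * k + 1 + 1) = E 0 := by simp only [t]; rw [if_pos hlast]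
        have hv : l.getVert (2 * k + 1 + 1) = v := by rw [hlast, l.getVert_length]
        have h01 : K.graph.Adj v (l.getVert 1) := by simpa using hadj 0 (by omega)
        rw [ht2]
        refine ⟨Adj.mem_edgesAt_right (hadj (2 * k) (by omega)), ?_, Or.inr ⟨hne, ?_, X, hX,
          hsub _ _, hsub _ _, hsub _ _⟩⟩
        · rw [hv]
          simp only [E, l.getVert_zero]
          exact Adj.mem_edgesAt_left h01
        · rw [hv]
          simp only [E, l.getVert_zero]
          intro h
          rw [Set.pair_comm (l.getVert (2 * k + 1))] at h
          have := hinj 1 (2 * k + 1) (by omega) (by omega) (pair_left_injective h)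
          omega
      · have ht2 : t (2 * k + 1 + 1) = E (2 * k + 1 + 1) := by
          simp only [t]; rw [if_neg hlast, if_pos ⟨k + 1, by ring⟩]
        have hlt : 2 * k + 1 + 1 < l.length := by omega
        rw [ht2]
        refine ⟨Adj.mem_edgesAt_right (hadj (2 * k) (by omega)), Adj.mem_edgesAt_left (hadj _ hlt),
          Or.inr ⟨hne, ?_, X, hX, hsub _ _, hsub _ _, hsub _ _⟩⟩
        intro h
        simp only [E] at h
        rw [Set.pair_comm (l.getVert (2 * k + 1))] at h
        exact hl.1.getVert_sub_one_ne_getVert_add_one (i := 2 * k + 1 + 1) hlt.le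
          (pair_left_injective h).symm

/-- Locality makes every 2-cell connected, so it is its only component. -/
theorem isTwoCellComponent_iff (hlocal : K.IsLocal 2) {D : Set V} :
    K.IsTwoCellComponent D ↔ D ∈ K.cell 2 := by
  have key : ∀ C ∈ K.cell 2, ∀ v ∈ C, C = {w | w ∈ C ∧ (K.restrict C).graph.Reachable v w} := by
    intro C hC v hv
    have hv' : ∀ w ∈ C, w ∈ (K.restrict C).vertices := fun w hw =>
      ⟨mem_vertices_of_mem hC hw, Set.singleton_subset_iff.2 hw⟩
    ext w
    exact ⟨fun hw => ⟨hw, (hlocal.2.2.2 2 C hC).2 v (hv' v hv) w (hv' w hw)⟩, fun hw => hw.1⟩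
  constructor
  · rintro ⟨C, hC, v, hv, rfl⟩
    rwa [← key C hC v hv]
  · intro hD
    obtain ⟨v, hv⟩ := K.nonempty_of_mem 2 D hD
    exact ⟨D, hD, v, hv, key D hD v hv⟩

/-- In a local, even, full, monodromy-free `2`-complex, the connection is trivial along all loops
around a `2`-cell. -/
theorem IsLoopAround.nablaPath_self (hlocal : K.IsLocal 2) (heven : K.IsEven) (hfull : K.IsFull 2)
    (hmon : K.IsMonodromyFree) {X : Set V} (hX : X ∈ K.cell 2) {v : V} {l : K.graph.Walk v v}
    (hl : K.IsLoopAround X l) {e : Set V} (he : e ∈ K.edgesAt v) : K.NablaPath l e e := by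
  classical
  have hD := (isTwoCellComponent_iff hlocal).2 hX
  obtain ⟨v₀, hv₀, l₀, hl₀, hfix⟩ := hmon X hD
  -- Monodromy-freeness covers the edges meeting `X` only in `v₀`. The two edges inside `X` are the
  -- first edges of `l₀` and of its reverse, which evenness takes care of.
  have hfix' : ∀ e ∈ K.edgesAt v₀, K.NablaPath l₀ e e := by
    intro e he
    by_cases heX : e ⊆ X
    · have h3 := hl₀.1.three_le_length
      have h1 : K.NablaPath l₀ {v₀, l₀.getVert 1} {v₀, l₀.getVert 1} :=
        hl₀.nablaPath_first hX (heven X hD)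
      have h2 : K.NablaPath l₀ {v₀, l₀.getVert (l₀.length - 1)}
          {v₀, l₀.getVert (l₀.length - 1)} := by
        have := hl₀.reverse.nablaPath_first hX (heven X hD)
        rwa [nablaPath_reverse, SimpleGraph.Walk.getVert_reverse] at this
      have a1 : K.graph.Adj v₀ (l₀.getVert 1) := by
        simpa using l₀.adj_getVert_succ (i := 0) (by omega)
      have a2 : K.graph.Adj v₀ (l₀.getVert (l₀.length - 1)) := by
        have := l₀.adj_getVert_succ (i := l₀.length - 1) (by omega)
        rw [show l₀.length - 1 + 1 = l₀.length by omega, l₀.getVert_length] at this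
        exact this.symm
      have hsub : ∀ i, ({v₀, l₀.getVert i} : Set V) ⊆ X := by
        rintro i x (rfl | rfl)
        · exact hv₀
        · exact hl₀.getVert_mem _
      have hne : ({v₀, l₀.getVert 1} : Set V) ≠ {v₀, l₀.getVert (l₀.length - 1)} := by
        intro h
        have : 1 = l₀.length - 1 := hl₀.1.getVert_injOn' (by simp only [Set.mem_ofPred_eq]; omega)
          (by simp only [Set.mem_ofPred_eq]; omega) (pair_left_injective h)
        omega
      rcases eq_or_eq_of_mem_edgesAtIn hX ⟨Adj.mem_edgesAt_left a1, hsub _⟩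
        ⟨Adj.mem_edgesAt_left a2, hsub _⟩ hne ⟨he, heX⟩ with rfl | rfl
      · exact h1
      · exact h2
    · refine hfix e he ?_
      obtain ⟨w, hw, rfl⟩ := hlocal.2.1.1.exists_adj he
      have : ({v₀, w} : Set V) ∩ X = {v₀} := by
        ext x
        simp only [Set.mem_inter_iff, Set.mem_insert_iff, Set.mem_singleton_iff]
        constructor
        · rintro ⟨rfl | rfl, hx⟩
          · rfl
          · exact absurd (by rintro y (rfl | rfl) <;> assumption) heX
        · rintro rfl
          exact ⟨Or.inl rfl, hv₀⟩
      rw [this, Set.ncard_singleton]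
  have hv : v ∈ l₀.support := by
    have : v ∈ X := by rw [← hl.2]; exact l.start_mem_support
    rw [← hl₀.2] at this
    exact this
  -- To change the base point, `e` is carried back to `v₀` and its image is extended to a parallel
  -- section, whose value at `v` is then `e`.
  obtain ⟨e', he', h⟩ := NablaPath.exists hfull (l₀.takeUntil v hv).reverse he
  obtain ⟨s, hs, rfl⟩ := hl₀.exists_isParallel hX (hfix' e' he')
  have h' := hs.nablaPath (l₀.takeUntil v hv) fun w hw => by
    rw [← hl₀.2]
    exact l₀.support_takeUntil_subset_support hv hw
  obtain rfl := (nablaPath_reverse.1 h).unique h'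
  exact hs.nablaPath l fun w hw => by rw [← hl.2]; exact hw

/-! ### Path independence -/

/-- Trivial transport around the loop `p` followed by the inverse of `p'` makes `p` and `p'` act
alike. A back-and-forth passage cancels by symmetry of the connection; fullness is needed to insert
one, as the edge must have an image. -/
theorem Move.nablaPath_iff (hlocal : K.IsLocal 2) (heven : K.IsEven) (hfull : K.IsFull 2)
    (hmon : K.IsMonodromyFree) {v w : V} {p q : K.graph.Walk v w} (h : K.Move p q) {e f : Set V}
    (he : e ∈ K.edgesAt v) : K.NablaPath p e f ↔ K.NablaPath q e f := by
  cases h with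
  | cell q₁ p p' q₂ D hD hl =>
    simp only [nablaPath_append]
    refine exists_congr fun g => and_congr_left fun _ => exists_congr fun g' =>
      and_congr_right fun hg' => ?_
    have hg := hg'.mem_edgesAt he
    obtain ⟨c, h1, h2⟩ := (nablaPath_append _ _).1
      (hl.nablaPath_self hlocal heven hfull hmon ((isTwoCellComponent_iff hlocal).1 hD) hg)
    rw [nablaPath_reverse] at h2
    constructor
    · intro h
      rwa [h.unique h1]
    · intro h
      rwa [h.unique h2]
  | edge q₁ h q₂ =>
    simp only [nablaPath_append, nablaPath_cons]
    refine exists_congr fun g => and_congr_right fun hg => ?_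
    constructor
    · rintro ⟨g', h1, g'', h2, h3⟩
      rwa [Nabla.unique h.symm h1.symm h2]
    · intro h3
      obtain ⟨g', h1⟩ := Nabla.exists hfull h (hg.mem_edgesAt he)
      exact ⟨g', h1, g, h1.symm, h3⟩

theorem Homotopic.nablaPath_iff (hlocal : K.IsLocal 2) (heven : K.IsEven) (hfull : K.IsFull 2)
    (hmon : K.IsMonodromyFree) {v w : V} {p q : K.graph.Walk v w} (h : K.Homotopic p q)
    {e f : Set V} (he : e ∈ K.edgesAt v) : K.NablaPath p e f ↔ K.NablaPath q e f := by
  induction h with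
  | rel _ _ h => exact h.nablaPath_iff hlocal heven hfull hmon he
  | refl => exact Iff.rfl
  | symm _ _ _ ih => exact ih.symm
  | trans _ _ _ _ _ ih1 ih2 => exact ih1.trans ih2

/-! ### Edge colourings from path-independent transport. -/

/-- A colouring of the edges by `C`, bijective at each vertex and parallel for the connection. -/
structure EdgeColoring (K : CellComplex V) (C : Type*) where
  color : Set V → C
  inj : ∀ v, ∀ e ∈ K.edgesAt v, ∀ f ∈ K.edgesAt v, color e = color f → e = f
  surj : ∀ v ∈ K.vertices, ∀ c, ∃ e ∈ K.edgesAt v, color e = c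
  parallel : ∀ v w e f, K.graph.Adj v w → K.Nabla v w e f → color e = color f

/-- The colour of an edge is the edge at `v₀` that transport carries to it. -/
theorem exists_edgeColoring (hlocal : K.IsLocal 2) (heven : K.IsEven) (hfull : K.IsFull 2)
    (hmon : K.IsMonodromyFree) (hsimply : K.IsSimplyConnected) {v₀ : V} (hv₀ : v₀ ∈ K.vertices)
    {e₀ : Set V} (he₀ : e₀ ∈ K.edgesAt v₀) : Nonempty (K.EdgeColoring (K.edgesAt v₀)) := by
  classical
  have hreach : ∀ v ∈ K.vertices, Nonempty (K.graph.Walk v₀ v) :=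
    fun v hv => hlocal.2.1.2 v₀ hv₀ v hv
  have hmem : ∀ {v} {e : Set V}, e ∈ K.edgesAt v → v ∈ K.vertices :=
    fun he => mem_vertices_of_mem he.1 he.2
  have hclosed : ∀ {v} (p q : K.graph.Walk v₀ v) {e f : Set V}, e ∈ K.edgesAt v₀ →
      K.NablaPath p e f → K.NablaPath q e f := by
    intro v p q e f he hp
    have h := ((hsimply.2 v₀ hv₀ (p.append q.reverse)).nablaPath_iff hlocal heven hfull hmon
      (f := e) he).2 rfl
    obtain ⟨g, h1, h2⟩ := (nablaPath_append _ _).1 h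
    rw [nablaPath_reverse] at h2
    rwa [hp.unique h1]
  -- The colour must not depend on which endpoint of `e` is reached; `hP` shows this, because the
  -- connection along `e` fixes `e`.
  let P : Set V → Set V → Prop := fun e g =>
    g ∈ K.edgesAt v₀ ∧ ∀ v, e ∈ K.edgesAt v → ∀ p : K.graph.Walk v₀ v, K.NablaPath p g e
  have hP : ∀ {v : V} {e g : Set V} (p : K.graph.Walk v₀ v), e ∈ K.edgesAt v →
      g ∈ K.edgesAt v₀ → K.NablaPath p g e → P e g := by
    intro v e g p he hg h
    refine ⟨hg, fun v' he' p' => ?_⟩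
    by_cases hvv : v' = v
    · subst hvv
      exact hclosed p p' hg h
    · obtain ⟨w, hw, rfl⟩ := hlocal.2.1.1.exists_adj he
      obtain rfl : v' = w := by
        have := he'.2
        simp only [Set.mem_insert_iff, Set.mem_singleton_iff] at this
        exact this.resolve_left hvv
      refine hclosed (p.append (.cons hw .nil)) p' hg ((nablaPath_append _ _).2 ⟨_, h, ?_⟩)
      exact ⟨_, Nabla.pair hw, rfl⟩
  have hex : ∀ {v : V} {e : Set V}, e ∈ K.edgesAt v → ∃ g, P e g := by
    intro v e he
    obtain ⟨p⟩ := hreach v (hmem he)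
    obtain ⟨g, hg, h⟩ := NablaPath.exists hfull p.reverse he
    exact ⟨g, hP p he hg (nablaPath_reverse.1 h)⟩
  -- The default only makes `col` total; edges always fall under the first case.
  let col : Set V → K.edgesAt v₀ := fun e =>
    if h : ∃ g, P e g then ⟨h.choose, h.choose_spec.1⟩ else ⟨e₀, he₀⟩
  have hcol : ∀ {v : V} {e : Set V}, e ∈ K.edgesAt v → P e (col e) := by
    intro v e he
    have h := hex he
    simp only [col, dif_pos h]
    exact h.choose_spec
  have hcol' : ∀ {v : V} {e : Set V} {g} (p : K.graph.Walk v₀ v), e ∈ K.edgesAt v →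
      K.NablaPath p g e → (col e : Set V) = g := fun p he h =>
    ((hcol he).2 _ he p).reverse.unique h.reverse
  refine ⟨⟨col, ?_, ?_, ?_⟩⟩
  · intro v e he f hf hef
    obtain ⟨p⟩ := hreach v (hmem he)
    have h := (hcol he).2 v he p
    rw [hef] at h
    exact h.unique ((hcol hf).2 v hf p)
  · rintro v hv ⟨c, hc⟩
    obtain ⟨p⟩ := hreach v hv
    obtain ⟨e, he, h⟩ := NablaPath.exists hfull p hc
    exact ⟨e, he, Subtype.ext (hcol' p he h)⟩
  · intro v w e f hvw h
    obtain ⟨p⟩ := hreach v (Adj.mem_vertices hvw)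
    refine Subtype.ext (hcol' (p.append (.cons hvw .nil)) h.2.1 ?_).symm
    exact (nablaPath_append _ _).2 ⟨e, (hcol h.1).2 v h.1 p, f, h, rfl⟩

/-! ### Colour components. -/

namespace EdgeColoring

variable {C : Type*} (φ : K.EdgeColoring C)

/-- The graph of the edges with colour in `S`. -/
def graph (S : Set C) : SimpleGraph V where
  Adj v w := K.graph.Adj v w ∧ φ.color {v, w} ∈ S
  symm := ⟨fun v w h => ⟨h.1.symm, Set.pair_comm v w ▸ h.2⟩⟩
  loopless := ⟨fun _ h => h.1.ne rfl⟩

/-- The connected component of `v` in the graph of the edges with colour in `S`. -/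
def comp (S : Set C) (v : V) : Set V := {w | (φ.graph S).Reachable v w}

theorem graph_mono {S T : Set C} (h : S ⊆ T) : φ.graph S ≤ φ.graph T :=
  fun _ _ hab => ⟨hab.1, h hab.2⟩

theorem mem_comp_self (S : Set C) (v : V) : v ∈ φ.comp S v := SimpleGraph.Reachable.refl v

theorem comp_eq {S : Set C} {v w : V} (h : w ∈ φ.comp S v) : φ.comp S w = φ.comp S v := by
  ext u
  exact ⟨fun hu => SimpleGraph.Reachable.trans h hu,
    fun hu => SimpleGraph.Reachable.trans (SimpleGraph.Reachable.symm h) hu⟩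

theorem comp_mono {S T : Set C} (h : S ⊆ T) (v : V) : φ.comp S v ⊆ φ.comp T v :=
  fun _ hw => SimpleGraph.Reachable.mono (φ.graph_mono h) hw

theorem mem_comp_of_adj {S : Set C} {v a b : V} (ha : a ∈ φ.comp S v)
    (hab : (φ.graph S).Adj a b) : b ∈ φ.comp S v :=
  SimpleGraph.Reachable.trans ha hab.reachable

/-- Reachability from `v` in the graph of colours `S` only involves the component of `v`. -/
theorem reachable_of_adj {S : Set C} {v a b : V} {H : SimpleGraph V}
    (hH : ∀ x ∈ φ.comp S v, ∀ y ∈ φ.comp S v, (φ.graph S).Adj x y → H.Adj x y)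
    (ha : a ∈ φ.comp S v) (hb : b ∈ φ.comp S v) : H.Reachable a b := by
  obtain ⟨p⟩ : (φ.graph S).Reachable a b :=
    SimpleGraph.Reachable.trans (SimpleGraph.Reachable.symm ha) hb
  clear hb
  induction p with
  | nil => exact SimpleGraph.Reachable.refl _
  | cons h p ih =>
    have hy := φ.mem_comp_of_adj ha h
    exact (hH _ ha _ hy h).reachable.trans (ih hy)

theorem comp_subset {S : Set C} {v : V} {A : Set V} (hv : v ∈ A)
    (hA : ∀ a ∈ A, ∀ b, (φ.graph S).Adj a b → b ∈ A) : φ.comp S v ⊆ A := by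
  rintro w ⟨p⟩
  induction p with
  | nil => exact hv
  | cons h p ih => exact ih (hA _ hv _ h)

theorem mem_vertices_of_mem_comp {S : Set C} {v w : V} (hv : v ∈ K.vertices)
    (hw : w ∈ φ.comp S v) : w ∈ K.vertices :=
  φ.comp_subset hv (fun _ _ _ h => Adj.mem_vertices h.1.symm) hw

theorem adj_of_mem_edgesAt (hg : K.IsGraphBased) {S : Set C} {v : V} {e : Set V}
    (he : e ∈ K.edgesAt v) (hS : φ.color e ∈ S) : ∃ w, (φ.graph S).Adj v w ∧ e = {v, w} := by
  obtain ⟨w, hw, rfl⟩ := hg.exists_adj he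
  exact ⟨w, ⟨hw, hS⟩, rfl⟩

theorem edge_subset_comp (hg : K.IsGraphBased) {S : Set C} {v : V} {e : Set V}
    (he : e ∈ K.edgesAt v) (hS : φ.color e ∈ S) : e ⊆ φ.comp S v := by
  obtain ⟨w, hw, rfl⟩ := φ.adj_of_mem_edgesAt hg he hS
  rintro x (rfl | rfl)
  · exact φ.mem_comp_self S x
  · exact hw.reachable

theorem ncard_preimage {v : V} (hv : v ∈ K.vertices) (S : Set C) :
    {e ∈ K.edgesAt v | φ.color e ∈ S}.ncard = S.ncard := by
  have h : φ.color '' {e ∈ K.edgesAt v | φ.color e ∈ S} = S := by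
    ext c
    constructor
    · rintro ⟨e, he, rfl⟩
      exact he.2
    · intro hc
      obtain ⟨e, he, rfl⟩ := φ.surj v hv c
      exact ⟨e, ⟨he, hc⟩, rfl⟩
  conv_rhs => rw [← h]
  exact (Set.InjOn.ncard_image fun e he f hf hef => φ.inj v e he.1 f hf.1 hef).symm

/-- A `2`-cell is a component for two colours. -/
theorem exists_comp_eq_of_twoCell (hlocal : K.IsLocal 2) {X : Set V} (hX : X ∈ K.cell 2) {v : V}
    (hv : v ∈ X) : ∃ S : Set C, S.ncard = 2 ∧ X = φ.comp S v ∧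
      ∀ w ∈ X, ∀ e ∈ K.edgesAt w, e ⊆ X ↔ φ.color e ∈ S := by
  -- `S w` collects the colours of the edges of `X` at `w`. Parallelism makes it constant along the
  -- edges of `X`, hence on all of `X`, which is connected.
  let S : V → Set C := fun w => φ.color '' K.edgesAtIn w X
  have hadj : ∀ {a b}, (K.restrict X).graph.Adj a b → S a ⊆ S b := by
    rintro a b ⟨hne, hab, hsub⟩ c ⟨e, ⟨he, heX⟩, rfl⟩
    have hab' : K.graph.Adj a b := ⟨hne, hab⟩
    by_cases h : e = {a, b}
    · exact ⟨e, ⟨h ▸ Adj.mem_edgesAt_right hab', heX⟩, rfl⟩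
    · obtain ⟨f, hf, hfne⟩ := exists_other_edge hX ⟨Adj.mem_edgesAt_right hab', hsub⟩
      refine ⟨f, hf, (φ.parallel a b e f hab' ⟨he, hf.1, Or.inr ⟨h, hfne, X, hX, hsub, heX, hf.2⟩⟩).symm⟩
  have hreach : ∀ w ∈ X, (K.restrict X).graph.Reachable v w := fun w hw =>
    (hlocal.2.2.2 2 X hX).2 v ⟨mem_vertices_of_mem hX hv, by simpa using hv⟩ w
      ⟨mem_vertices_of_mem hX hw, by simpa using hw⟩
  have hS : ∀ w ∈ X, S w = S v := by
    intro w hw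
    obtain ⟨p⟩ := hreach w hw
    clear hw
    induction p with
    | nil => rfl
    | cons h p ih =>
      have hv' : _ ∈ X := h.2.2 (Set.mem_insert_of_mem _ rfl)
      have hw' := fun w hw => (hlocal.2.2.2 2 X hX).2 _ ⟨mem_vertices_of_mem hX hv', by simpa using hv'⟩ w
        ⟨mem_vertices_of_mem hX hw, by simpa using hw⟩
      rw [ih hv' hw']
      exact (hadj h.symm).antisymm (hadj h)
  have hiff : ∀ w ∈ X, ∀ e ∈ K.edgesAt w, e ⊆ X ↔ φ.color e ∈ S v := by
    intro w hw e he
    rw [← hS w hw]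
    constructor
    · intro h
      exact ⟨e, ⟨he, h⟩, rfl⟩
    · rintro ⟨f, hf, h⟩
      rw [← φ.inj w f hf.1 e he h]
      exact hf.2
  refine ⟨S v, ?_, ?_, hiff⟩
  · simp only [S]
    rw [Set.InjOn.ncard_image fun e he f hf h => φ.inj v e he.1 f hf.1 h, ncard_edgesAtIn hX hv]
  · ext w
    constructor
    · intro hw
      refine SimpleGraph.Reachable.mono (G := (K.restrict X).graph) ?_ (hreach w hw)
      intro a b hab
      exact ⟨⟨hab.1, hab.2.1⟩, (hiff a (hab.2.2 (by simp)) _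
        (Adj.mem_edgesAt_left ⟨hab.1, hab.2.1⟩)).1 hab.2.2⟩
    · intro hw
      -- Conversely, an edge at a vertex of `X` with colour in `S v` stays in `X`, so the component
      -- cannot leave `X`.
      refine φ.comp_subset hv (fun a ha b hab => ?_) hw
      exact (hiff a ha _ (Adj.mem_edgesAt_left hab.1)).2 hab.2 (by simp)

end EdgeColoring
/-- The cells of `K` satisfying a property that passes to subsets. -/
def ofLower (K : CellComplex V) (P : Set V → Prop) (hP : ∀ x y, x ⊆ y → P y → P x) :
    CellComplex V where
  cell r := {x | x ∈ K.cell r ∧ P x}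
  finite_vertices := K.finite_vertices.subset fun _ h => h.1
  nonempty_of_mem r x h := K.nonempty_of_mem r x h.1
  rank_unique r s x h h' := K.rank_unique r s x h.1 h'.1
  eq_singleton x h := K.eq_singleton x h.1
  singleton_mem r x h v hv :=
    ⟨K.singleton_mem r x h.1 v hv, hP _ _ (Set.singleton_subset_iff.2 hv) h.2⟩
  rank_lt r s x y h h' hxy := K.rank_lt r s x y h.1 h'.1 hxy
  inter_mem r s x y h h' hne := by
    obtain ⟨t, ht⟩ := K.inter_mem r s x y h.1 h'.1 hne
    exact ⟨t, ht, hP _ _ Set.inter_subset_left h.2⟩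
  exists_coface r s x y h h' hxy := by
    obtain ⟨z, hz, hxz, hzy⟩ := K.exists_coface r s x y h.1 h'.1 hxy
    exact ⟨z, ⟨hz, hP _ _ hzy h'.2⟩, hxz, hzy⟩
  diamond r x y h h' hxy := by
    rw [← K.diamond r x y h.1 h'.1 hxy]
    congr 1
    ext z
    exact ⟨fun hz => ⟨hz.1.1, hz.2⟩, fun hz => ⟨⟨hz.1, hP _ _ hz.2.2 h'.2⟩, hz.2⟩⟩

/-! ### Induced sub-complexes from sets of colours, and their intersections. -/

namespace EdgeColoring

variable {C : Type*} (φ : K.EdgeColoring C)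

/-- The subcomplex of the cells in a component, all of whose edges have colour in `S`. -/
def sub (S : Set C) (v : V) : CellComplex V :=
  -- The colour condition matters: without non-singularity, an edge of another colour could join two
  -- vertices of the component.
  K.ofLower (fun x => x ⊆ φ.comp S v ∧ ∀ e ∈ K.cell 1, e ⊆ x → φ.color e ∈ S)
    fun _ _ hxy hy => ⟨hxy.trans hy.1, fun e he hex => hy.2 e he (hex.trans hxy)⟩

theorem vertices_sub {S : Set C} {v : V} (hv : v ∈ K.vertices) :
    (φ.sub S v).vertices = φ.comp S v := by
  ext w
  constructor
  · intro h
    exact h.2.1 rfl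
  · intro h
    have hw := φ.mem_vertices_of_mem_comp hv h
    refine ⟨hw, Set.singleton_subset_iff.2 h, fun e he hew => ?_⟩
    rcases (hew.eq_or_ssubset) with rfl | h'
    · exact absurd (K.rank_unique 0 1 _ hw he) (by omega)
    · exact absurd (K.rank_lt 1 0 _ _ he hw h') (by omega)

theorem mem_sub_cell_one (hg : K.IsGraphBased) {S : Set C} {u v : V} (hu : u ∈ φ.comp S v)
    {e : Set V} (he : e ∈ K.edgesAt u) : e ∈ (φ.sub S v).cell 1 ↔ φ.color e ∈ S := by
  constructor
  · intro h
    exact h.2.2 e he.1 subset_rfl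
  · intro h
    refine ⟨he.1, ?_, fun f hf hfe => by rwa [eq_of_subset hf he.1 hfe]⟩
    rw [← φ.comp_eq hu]
    exact φ.edge_subset_comp hg he h

theorem edgesAt_sub (hg : K.IsGraphBased) {S : Set C} {u v : V} (hu : u ∈ φ.comp S v) :
    (φ.sub S v).edgesAt u = {e ∈ K.edgesAt u | φ.color e ∈ S} := by
  ext e
  constructor
  · rintro ⟨he, heu⟩
    exact ⟨⟨he.1, heu⟩, (φ.mem_sub_cell_one hg hu ⟨he.1, heu⟩).1 he⟩
  · rintro ⟨he, hS⟩
    exact ⟨(φ.mem_sub_cell_one hg hu he).2 hS, he.2⟩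

theorem graph_sub_adj (hg : K.IsGraphBased) {S : Set C} {a b v : V} :
    (φ.sub S v).graph.Adj a b ↔ a ∈ φ.comp S v ∧ (φ.graph S).Adj a b := by
  constructor
  · rintro ⟨hne, h⟩
    exact ⟨h.2.1 (by simp), ⟨hne, h.1⟩, h.2.2 _ h.1 subset_rfl⟩
  · rintro ⟨ha, h, hS⟩
    exact ⟨h.1, (φ.mem_sub_cell_one hg ha (Adj.mem_edgesAt_left h)).2 hS⟩

/-- A 2-cell carries only two colours, so those of `e` and `f` are all of them and the cell is a
component for a subset of `S`. -/
theorem mem_sub_cell_two (hlocal : K.IsLocal 2) {S : Set C} {u v : V} (hu : u ∈ φ.comp S v)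
    {X e f : Set V} (hX : X ∈ K.cell 2) (he : e ∈ K.edgesAtIn u X) (hf : f ∈ K.edgesAtIn u X)
    (hef : e ≠ f) (heS : φ.color e ∈ S) (hfS : φ.color f ∈ S) : X ∈ (φ.sub S v).cell 2 := by
  obtain ⟨T, hT, hXT, h⟩ := φ.exists_comp_eq_of_twoCell hlocal hX (he.2 he.1.2)
  have hTS : T ⊆ S := by
    have hfin : T.Finite := Set.finite_of_ncard_pos (by omega)
    have : {φ.color e, φ.color f} = T := by
      refine Set.eq_of_subset_of_ncard_le ?_ ?_ hfin
      · rintro c (rfl | rfl)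
        · exact (h u (he.2 he.1.2) e he.1).1 he.2
        · exact (h u (he.2 he.1.2) f hf.1).1 hf.2
      · rw [hT, Set.ncard_pair fun hc => hef (φ.inj u e he.1 f hf.1 hc)]
    rw [← this]
    rintro c (rfl | rfl) <;> assumption
  refine ⟨hX, ?_, fun g hg hgX => ?_⟩
  · rw [hXT, ← φ.comp_eq hu]
    exact φ.comp_mono hTS u
  · obtain ⟨w, hw⟩ := K.nonempty_of_mem 1 g hg
    exact hTS ((h w (hgX hw) g ⟨hg, hw⟩).1 hgX)

theorem graph_restrict_sub {S : Set C} {v : V} {r : ℕ} {x : Set V}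
    (hx : x ∈ (φ.sub S v).cell r) : ((φ.sub S v).restrict x).graph = (K.restrict x).graph := by
  ext a b
  constructor
  · rintro ⟨hne, h, hsub⟩
    exact ⟨hne, h.1, hsub⟩
  · rintro ⟨hne, h, hsub⟩
    exact ⟨hne, ⟨h, hsub.trans hx.2.1, fun e he hex => hx.2.2 e he (hex.trans hsub)⟩, hsub⟩

/-- Transport preserves colours, so it cannot leave the sub-complex; the 2-cell it uses has two
edges coloured in `S` and therefore belongs to it. -/
theorem nabla_sub (hlocal : K.IsLocal 2) {S : Set C} {v a b : V} {e f : Set V}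
    (hab : (φ.sub S v).graph.Adj a b) (he : e ∈ (φ.sub S v).edgesAt a) (h : K.Nabla a b e f) :
    (φ.sub S v).Nabla a b e f := by
  have hg := hlocal.2.1.1
  have hab' := (φ.graph_sub_adj hg).1 hab
  have hb := φ.mem_comp_of_adj hab'.1 hab'.2
  have hf : f ∈ (φ.sub S v).edgesAt b := by
    rw [φ.edgesAt_sub hg hb]
    rw [φ.edgesAt_sub hg hab'.1] at he
    exact ⟨h.2.1, by rw [← φ.parallel a b e f hab'.2.1 h]; exact he.2⟩
  refine ⟨he, hf, ?_⟩
  rcases h.2.2 with h1 | ⟨h1, h2, X, hX, h3, h4, h5⟩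
  · exact Or.inl h1
  · refine Or.inr ⟨h1, h2, X, ?_, h3, h4, h5⟩
    rw [φ.edgesAt_sub hg hab'.1] at he
    exact φ.mem_sub_cell_two hlocal hab'.1 hX ⟨he.1, h4⟩
      ⟨Adj.mem_edgesAt_left hab'.2.1, h3⟩ h1 he.2 hab'.2.2

theorem nablaPath_sub (hlocal : K.IsLocal 2) {S : Set C} {v a b : V} {e f : Set V}
    (p : K.graph.Walk a b) (hp : ∀ x ∈ p.edges, x ∈ (φ.sub S v).graph.edgeSet)
    (he : e ∈ (φ.sub S v).edgesAt a) (h : K.NablaPath p e f) :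
    (φ.sub S v).NablaPath (p.transfer _ hp) e f := by
  induction p generalizing e with
  | nil => exact h
  | cons hab p ih =>
    obtain ⟨g, h1, h2⟩ := h
    have hp' := hp
    simp only [SimpleGraph.Walk.edges_cons, List.mem_cons, forall_eq_or_imp] at hp'
    have h3 := φ.nabla_sub hlocal hp'.1 he h1
    exact ⟨g, h3, ih hp'.2 h3.2.1 h2⟩

theorem hasRank_sub (hlocal : K.IsLocal 2) (hfull : K.IsFull 2) {S : Set C} {v : V}
    (hv : v ∈ K.vertices) (hS : 2 ≤ S.ncard) : (φ.sub S v).HasRank 2 := by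
  refine ⟨fun r hr => hlocal.1.1 r (hr.mono fun _ h => h.1), fun n hn => hn 2 ?_⟩
  have hfin : S.Finite := Set.finite_of_ncard_pos (by omega)
  obtain ⟨c, d, hc, hd, hcd⟩ := (Set.one_lt_ncard_iff hfin).1 hS
  obtain ⟨e, he, rfl⟩ := φ.surj v hv c
  obtain ⟨f, hf, rfl⟩ := φ.surj v hv d
  have hef : e ≠ f := fun h => hcd (h ▸ rfl)
  obtain ⟨X, hX, -, h1, h2⟩ := hfull.exists_twoCell he hf hef
  exact ⟨X, φ.mem_sub_cell_two hlocal (φ.mem_comp_self S v) hX ⟨he, h1⟩ ⟨hf, h2⟩ hef hc hd⟩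

theorem isLocal_sub (hlocal : K.IsLocal 2) (hfull : K.IsFull 2) {S : Set C} {v : V}
    (hv : v ∈ K.vertices) (hS : 2 ≤ S.ncard) : (φ.sub S v).IsLocal 2 := by
  have hg : (φ.sub S v).IsGraphBased := fun e he => hlocal.2.1.1 e he.1
  refine ⟨φ.hasRank_sub hlocal hfull hv hS, ⟨hg, fun a ha b hb => ?_⟩, hg, fun r x hx => ?_⟩
  · rw [φ.vertices_sub hv] at ha hb
    exact φ.reachable_of_adj (fun x hx y _ h => (φ.graph_sub_adj hlocal.2.1.1).2 ⟨hx, h⟩) ha hb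
  · refine ⟨fun e he => hg e he.1, fun a ha b hb => ?_⟩
    rw [φ.graph_restrict_sub hx]
    exact (hlocal.2.2.2 r x hx.1).2 a ⟨ha.1.1, ha.2⟩ b ⟨hb.1.1, hb.2⟩

theorem isFull_sub (hlocal : K.IsLocal 2) (hfull : K.IsFull 2) {S : Set C} {v : V}
    (hv : v ∈ K.vertices) (hS : 2 ≤ S.ncard) : (φ.sub S v).IsFull 2 := by
  refine ⟨⟨2, φ.hasRank_sub hlocal hfull hv hS, le_rfl, le_rfl⟩, fun u hu k hk hk' E hE hcard => ?_⟩
  obtain rfl : k = 2 := le_antisymm hk' hk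
  rw [φ.vertices_sub hv] at hu
  have hE' := hE
  rw [φ.edgesAt_sub hlocal.2.1.1 hu] at hE'
  obtain ⟨e, f, hef, rfl⟩ := Set.ncard_eq_two.1 hcard
  have he := hE' (show e ∈ _ by simp)
  have hf := hE' (show f ∈ _ by simp)
  obtain ⟨X, hX, h, h1, h2⟩ := hfull.exists_twoCell he.1 hf.1 hef
  refine ⟨X, φ.mem_sub_cell_two hlocal hu hX ⟨he.1, h1⟩ ⟨hf.1, h2⟩ hef he.2 hf.2, ?_⟩
  ext g
  constructor
  · rintro ⟨hg, hgX⟩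
    rw [← h]
    exact ⟨⟨hg.1.1, hg.2⟩, hgX⟩
  · intro hg
    exact ⟨hE hg, by rcases hg with rfl | rfl <;> assumption⟩

theorem isMonodromyFree_sub (hlocal : K.IsLocal 2) (hfull : K.IsFull 2)
    (hmon : K.IsMonodromyFree) {S : Set C} {v : V}
    (hv : v ∈ K.vertices) (hS : 2 ≤ S.ncard) : (φ.sub S v).IsMonodromyFree := by
  intro D hD
  have hDsub := (isTwoCellComponent_iff (φ.isLocal_sub hlocal hfull hv hS)).1 hD
  obtain ⟨u, hu, l, hl, h⟩ := hmon D ((isTwoCellComponent_iff hlocal).2 hDsub.1)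
  have hp : ∀ x ∈ l.edges, x ∈ (φ.sub S v).graph.edgeSet := by
    intro x hx
    induction x with
    | _ a b =>
      have hab := l.adj_of_mem_edges hx
      have ha : a ∈ D := by rw [← hl.2]; exact l.fst_mem_support_of_mem_edges hx
      have hb : b ∈ D := by rw [← hl.2]; exact l.snd_mem_support_of_mem_edges hx
      have hsub : ({a, b} : Set V) ⊆ D := by rintro y (rfl | rfl) <;> assumption
      exact ⟨hab.1, hab.2, hsub.trans hDsub.2.1, fun e he hex => hDsub.2.2 e he (hex.trans hsub)⟩
  refine ⟨u, hu, l.transfer _ hp, ⟨hl.1.transfer hp, by simpa using hl.2⟩, fun e he hcard => ?_⟩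
  exact φ.nablaPath_sub hlocal l hp he (h e ⟨he.1.1, he.2⟩ hcard)

/-- This makes the hypotheses on induced cells, maximality of `R` and non-singularity, available for
colour components. -/
theorem isInducedSub_sub (hlocal : K.IsLocal 2) (heven : K.IsEven) (hfull : K.IsFull 2)
    (hmon : K.IsMonodromyFree) {S : Set C} {v : V} (hv : v ∈ K.vertices) (hS : 2 ≤ S.ncard)
    (hne : S ≠ Set.univ) : K.IsInducedSub S.ncard (φ.sub S v) := by
  have hg := hlocal.2.1.1
  refine ⟨v, hv, {e ∈ K.edgesAt v | φ.color e ∈ S}, ?_, hS, φ.ncard_preimage hv S,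
    fun r x hx => hx.1, ⟨fun e he => hg e he.1, fun u hu => ?_⟩,
    φ.isLocal_sub hlocal hfull hv hS, fun D hD => ?_, φ.isFull_sub hlocal hfull hv hS,
    φ.isMonodromyFree_sub hlocal hfull hmon hv hS, ?_⟩
  · refine (Set.sep_subset _ _).ssubset_of_ne fun h => hne (Set.eq_univ_of_forall fun c => ?_)
    obtain ⟨e, he, rfl⟩ := φ.surj v hv c
    rw [← h] at he
    exact he.2
  · rw [φ.vertices_sub hv] at hu
    rw [φ.edgesAt_sub hg hu]
    exact φ.ncard_preimage (φ.mem_vertices_of_mem_comp hv hu) S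
  · have hDsub := (isTwoCellComponent_iff (φ.isLocal_sub hlocal hfull hv hS)).1 hD
    exact heven D ((isTwoCellComponent_iff hlocal).2 hDsub.1)
  · rw [← φ.edgesAt_sub hg (φ.mem_comp_self S v)]
    ext e
    exact ⟨fun h => ⟨h.1, h.2.2⟩, fun h => ⟨h.1, h.1.1, h.2⟩⟩

/-- The largest rank of an induced cell is one less than the number of colours. -/
theorem card_eq_of_isGreatest [Finite C] (φ : K.EdgeColoring C) (hlocal : K.IsLocal 2)
    (heven : K.IsEven) (hfull : K.IsFull 2) (hmon : K.IsMonodromyFree) {R : ℕ}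
    (hR : IsGreatest {r : ℕ | (K.inducedCells r).Nonempty} R) : 2 ≤ R ∧ Nat.card C = R + 1 := by
  obtain ⟨⟨x, J, ⟨v, hv, E, hE, hR2, hcard, -⟩, -⟩, hmax⟩ := hR
  have hn : (K.edgesAt v).ncard = Nat.card C := by
    have := φ.ncard_preimage hv Set.univ
    simpa [Set.ncard_univ] using this
  have hfin : (K.edgesAt v).Finite := by
    refine Set.Finite.of_finite_image (Set.toFinite (φ.color '' K.edgesAt v)) ?_
    exact fun e he f hf h => φ.inj v e he f hf h
  have h1 : R < Nat.card C := by
    rw [← hcard, ← hn]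
    exact Set.ncard_lt_ncard hE hfin
  refine ⟨hR2, le_antisymm ?_ h1⟩
  by_contra! hlt
  obtain ⟨c⟩ : Nonempty C := (Nat.card_pos_iff.1 (by omega)).1
  -- Omitting one colour gives an induced cell of rank `Nat.card C - 1`, which would exceed `R`.
  have hc : ({c}ᶜ : Set C).ncard = Nat.card C - 1 := by
    rw [Set.ncard_compl, Set.ncard_singleton]
  have h2 : 2 ≤ ({c}ᶜ : Set C).ncard := by omega
  have := hmax (show ({c}ᶜ : Set C).ncard ∈ _ from ⟨_, _, φ.isInducedSub_sub hlocal heven hfull hmon hv h2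
    (fun h => by have : c ∈ ({c}ᶜ : Set C) := h ▸ Set.mem_univ c
                 exact this rfl), rfl⟩)
  omega

/-- Components for different sets of colours intersect in components. -/
theorem reachable_inter [Finite C] (hlocal : K.IsLocal 2) (heven : K.IsEven) (hfull : K.IsFull 2)
    (hmon : K.IsMonodromyFree) {R : ℕ} (hcard : Nat.card C = R + 1)
    (hnonsing : ∀ r, 2 ≤ r → r ≤ R → K.NonsingularInducedCells r) {v : V} (hv : v ∈ K.vertices) :
    ∀ (n : ℕ) (S T : Set C) (w : V), S.ncard + T.ncard = n → w ∈ φ.comp S v → w ∈ φ.comp T v →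
      w ∈ φ.comp (S ∩ T) v := by
  have hg := hlocal.2.1.1
  have hltR : ∀ S T : Set C, ¬ T ⊆ S → S.ncard < R + 1 := by
    intro S T h
    rw [← hcard, ← Set.ncard_univ]
    refine Set.ncard_lt_ncard (Set.ssubset_univ_iff.2 ?_) (Set.toFinite _)
    rintro rfl
    exact h (Set.subset_univ _)
  -- Non-singularity compares only induced cells of equal rank, so it settles incomparable sets of
  -- equal size directly.
  have hsame : ∀ (S T : Set C) (w : V), S.ncard = T.ncard → 2 ≤ S.ncard → ¬ T ⊆ S → ¬ S ⊆ T →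
      w ∈ φ.comp S v → w ∈ φ.comp T v → w ∈ φ.comp (S ∩ T) v := by
    intro S T w hST h2 hTS hST' hS hT
    have hlt := hltR S T hTS
    have hJ := φ.isInducedSub_sub hlocal heven hfull hmon (S := S) hv h2
      (by rintro rfl; exact hTS (Set.subset_univ _))
    have hJ' := φ.isInducedSub_sub hlocal heven hfull hmon (S := T) hv (by omega)
      (by rintro rfl; exact hST' (Set.subset_univ _))
    rw [← hST] at hJ'
    have := hnonsing S.ncard h2 (by omega) _ _ hJ hJ' v
      (by rw [φ.vertices_sub hv, φ.vertices_sub hv]; exact ⟨φ.mem_comp_self S v, φ.mem_comp_self T v⟩) w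
      (by rw [φ.vertices_sub hv, φ.vertices_sub hv]; exact ⟨hS, hT⟩)
    refine SimpleGraph.Reachable.mono (fun a b hab => ?_) this
    have h1 := (φ.graph_sub_adj hg).1 hab.1
    have h2 := (φ.graph_sub_adj hg).1 hab.2
    exact ⟨h1.2.1, h1.2.2, h2.2.2⟩
  -- Non-singularity says nothing below two colours. There a component is a vertex or an edge, since
  -- a colour occurs only once at each vertex.
  have hsmall : ∀ (S : Set C) (w : V), S.ncard ≤ 1 → w ∈ φ.comp S v → w = v ∨
      ∃ e ∈ K.edgesAt v, e = {v, w} ∧ v ≠ w ∧ φ.color e ∈ S := by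
    intro S w hS hw
    have := φ.comp_subset (A := {w | w = v ∨ ∃ e ∈ K.edgesAt v, e = {v, w} ∧ v ≠ w ∧ φ.color e ∈ S})
      (S := S) (v := v) (Or.inl rfl) ?_ hw
    · exact this
    · rintro a (rfl | ⟨e, he, rfl, hne, hc⟩) b hab
      · exact Or.inr ⟨_, Adj.mem_edgesAt_left hab.1, rfl, hab.1.1, hab.2⟩
      · left
        have hceq := (Set.ncard_le_one_iff).1 hS hc hab.2
        have := φ.inj a _ ⟨he.1, by simp⟩ _ (Adj.mem_edgesAt_left hab.1) hceq
        rw [Set.pair_comm] at this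
        exact (pair_left_injective this).symm
  intro n
  induction n using Nat.strong_induction_on with
  | _ n ih =>
    have main : ∀ (S T : Set C) (w : V), S.ncard + T.ncard = n → S.ncard ≤ T.ncard →
        w ∈ φ.comp S v → w ∈ φ.comp T v → w ∈ φ.comp (S ∩ T) v := by
      intro S T w hn hle hS hT
      by_cases hST : S ⊆ T
      · rwa [Set.inter_eq_left.2 hST]
      by_cases hTS : T ⊆ S
      · rwa [Set.inter_eq_right.2 hTS]
      by_cases h1 : T.ncard ≤ 1
      · rcases hsmall S w (by omega) hS with rfl | ⟨e, he, rfl, hne, hc⟩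
        · exact φ.mem_comp_self _ _
        rcases hsmall T w h1 hT with rfl | ⟨f, hf, rfl, -, hc'⟩
        · exact φ.mem_comp_self _ _
        exact SimpleGraph.Adj.reachable ⟨⟨hne, he.1⟩, hc, hc'⟩
      have hlt := hltR T S hST
      -- Enlarging `S` to `U` of the size of `T` reduces to the equal-size case and places `w` in
      -- the component for `U ∩ T`. This set is smaller than `T`, and `S ∩ (U ∩ T) = S ∩ T`, so
      -- induction on the total size finishes.
      obtain ⟨U, hSU, hU⟩ : ∃ U : Set C, S ⊆ U ∧ U.ncard = T.ncard := by
        obtain ⟨U, hU, -, hU'⟩ := Set.exists_subsuperset_card_eq (Set.subset_univ S) hle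
          (by rw [Set.ncard_univ]; omega)
        exact ⟨U, hU, hU'⟩
      have hUT : ¬ U ⊆ T := fun h => hST (hSU.trans h)
      have hTU : ¬ T ⊆ U := fun h => hUT (Set.eq_of_subset_of_ncard_le h hU.le (Set.toFinite _)).ge
      have hw := hsame U T w hU (by omega) hTU hUT (φ.comp_mono hSU v hS) hT
      have hcard' : (U ∩ T).ncard < T.ncard :=
        Set.ncard_lt_ncard (Set.inter_subset_right.ssubset_of_ne fun h =>
          hTU (Set.inter_eq_right.1 h)) (Set.toFinite _)
      have := ih (S.ncard + (U ∩ T).ncard) (by omega) S (U ∩ T) w rfl hS hw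
      rwa [← Set.inter_assoc, Set.inter_eq_left.2 hSU] at this
    intro S T w hn hS hT
    rcases le_total S.ncard T.ncard with h | h
    · exact main S T w hn h hS hT
    · rw [Set.inter_comm]
      exact main T S w (by omega) h hT hS

end EdgeColoring
theorem ext_cell {A B : CellComplex V} (h : A.cell = B.cell) : A = B := by
  cases A
  cases B
  cases h
  rfl

/-! ### The ambient complex of colour components. -/

namespace EdgeColoring

variable {C : Type*} (φ : K.EdgeColoring C)

/-- Components at the same vertex, for any two sets of colours, intersect in the component for the
common colours. -/
def IsNonsingular : Prop :=
  ∀ v ∈ K.vertices, ∀ S T w, w ∈ φ.comp S v → w ∈ φ.comp T v → w ∈ φ.comp (S ∩ T) v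

theorem comp_empty (v : V) : φ.comp ∅ v = {v} := by
  refine (φ.comp_subset (A := {v}) rfl fun a _ b hab => ?_).antisymm
    (Set.singleton_subset_iff.2 (φ.mem_comp_self _ v))
  exact absurd hab.2 (Set.notMem_empty _)

theorem comp_singleton (hg : K.IsGraphBased) {v : V} {e : Set V} (he : e ∈ K.edgesAt v) :
    φ.comp {φ.color e} v = e := by
  refine (φ.comp_subset he.2 fun a ha b hab => ?_).antisymm (φ.edge_subset_comp hg he rfl)
  rw [← φ.inj a _ (Adj.mem_edgesAt_left hab.1) e ⟨he.1, ha⟩ hab.2]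
  simp

variable {φ}

theorem IsNonsingular.comp_inter (hI : φ.IsNonsingular) {v : V} (hv : v ∈ K.vertices)
    (S T : Set C) : φ.comp S v ∩ φ.comp T v = φ.comp (S ∩ T) v :=
  Set.Subset.antisymm (fun w hw => hI v hv S T w hw.1 hw.2)
    (Set.subset_inter (φ.comp_mono Set.inter_subset_left v) (φ.comp_mono Set.inter_subset_right v))

/-- If the colour of an edge `e` at `v` were in `S` but not in `T`, then `e` would lie in the
intersection of the components for its own colour and for `T`, which is `{v}`; but an edge has two
vertices. Thus a component remembers its colours, and ranks are well defined. -/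
theorem IsNonsingular.comp_subset_iff (hI : φ.IsNonsingular) (hg : K.IsGraphBased) {v : V}
    (hv : v ∈ K.vertices) {S T : Set C} : φ.comp S v ⊆ φ.comp T v ↔ S ⊆ T := by
  refine ⟨fun h c hc => ?_, fun h => φ.comp_mono h v⟩
  obtain ⟨e, he, rfl⟩ := φ.surj v hv c
  by_contra hcT
  have h1 : e ⊆ φ.comp {φ.color e} v ∩ φ.comp T v := by
    rw [φ.comp_singleton hg he]
    exact Set.subset_inter subset_rfl ((φ.edge_subset_comp hg he hc).trans h)
  rw [hI.comp_inter hv, Set.singleton_inter_eq_empty.2 hcT, φ.comp_empty] at h1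
  have h2 := Set.ncard_le_ncard h1
  rw [hg e he.1, Set.ncard_singleton] at h2
  omega

theorem IsNonsingular.comp_injective (hI : φ.IsNonsingular) (hg : K.IsGraphBased) {v : V}
    (hv : v ∈ K.vertices) {S T : Set C} (h : φ.comp S v = φ.comp T v) : S = T :=
  ((hI.comp_subset_iff hg hv).1 h.le).antisymm ((hI.comp_subset_iff hg hv).1 h.ge)

theorem comp_eq_of_subset {S T : Set C} {v w : V} (h : φ.comp S v ⊆ φ.comp T w) :
    φ.comp T w = φ.comp T v := (φ.comp_eq (h (φ.mem_comp_self S v))).symm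

/-- The components for at most `R` colours. -/
def ambientCell (φ : K.EdgeColoring C) (R r : ℕ) : Set (Set V) :=
  {x | r ≤ R ∧ ∃ v ∈ K.vertices, ∃ S : Set C, S.ncard = r ∧ x = φ.comp S v}

theorem IsNonsingular.exists_of_mem_superset {R r : ℕ} {v : V}
    {S : Set C} {z : Set V} (hI : φ.IsNonsingular) (hg : K.IsGraphBased) (hv : v ∈ K.vertices)
    (hz : z ∈ φ.ambientCell R r) (hSz : φ.comp S v ⊆ z) :
    ∃ T, S ⊆ T ∧ T.ncard = r ∧ z = φ.comp T v := by
  obtain ⟨-, w, hw, T, hT, rfl⟩ := hz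
  have h := comp_eq_of_subset hSz
  rw [h] at hSz ⊢
  exact ⟨T, (hI.comp_subset_iff hg hv).1 hSz, hT, rfl⟩

theorem exists_of_mem_ambientCell {R r : ℕ} {v : V} {z : Set V}
    (hz : z ∈ φ.ambientCell R r) (hv : v ∈ z) :
    v ∈ K.vertices ∧ ∃ T : Set C, T.ncard = r ∧ z = φ.comp T v := by
  obtain ⟨-, w, hw, T, hT, rfl⟩ := hz
  exact ⟨φ.mem_vertices_of_mem_comp hw hv, T, hT, (φ.comp_eq hv).symm⟩

/-- Raising the rank by one means adding one colour. The count serves both the diamond axiom, with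
`T` two colours larger than `S`, and closedness, with `T` the set of all colours. -/
theorem IsNonsingular.ncard_between [Finite C] {R : ℕ} (hI : φ.IsNonsingular)
    (hg : K.IsGraphBased) {v : V} (hv : v ∈ K.vertices) {S T : Set C} (hS : S.ncard + 1 ≤ R) :
    {z | z ∈ φ.ambientCell R (S.ncard + 1) ∧ φ.comp S v ⊆ z ∧ z ⊆ φ.comp T v}.ncard =
      {c | c ∉ S ∧ insert c S ⊆ T}.ncard := by
  rw [← Set.InjOn.ncard_image (f := fun c => φ.comp (insert c S) v)
    (s := {c | c ∉ S ∧ insert c S ⊆ T})]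
  · congr 1
    ext z
    constructor
    · rintro ⟨hz, hSz, hzT⟩
      obtain ⟨U, hSU, hU, rfl⟩ := hI.exists_of_mem_superset hg hv hz hSz
      obtain ⟨c, hc, rfl⟩ := (Set.exists_eq_insert_iff_ncard (Set.toFinite S)).2 ⟨hSU, hU.symm⟩
      exact ⟨c, ⟨hc, (hI.comp_subset_iff hg hv).1 hzT⟩, rfl⟩
    · rintro ⟨c, ⟨hc, hcT⟩, rfl⟩
      exact ⟨⟨hS, v, hv, _, Set.ncard_insert_of_notMem hc, rfl⟩,
        φ.comp_mono (Set.subset_insert c S) v, φ.comp_mono hcT v⟩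
  · intro c hc d hd hcd
    have := hI.comp_injective hg hv hcd
    have h1 : c ∈ insert d S := this ▸ Set.mem_insert c S
    exact h1.resolve_right hc.1

/-- The cell complex of the components for at most `R` colours. -/
def ambient [Finite C] (φ : K.EdgeColoring C) (hg : K.IsGraphBased) (hI : φ.IsNonsingular)
    (R : ℕ) : CellComplex V where
  cell r := φ.ambientCell R r
  finite_vertices := by
    refine K.finite_vertices.subset ?_
    rintro v ⟨-, w, hw, S, -, h⟩
    exact φ.mem_vertices_of_mem_comp hw (h.le rfl)
  nonempty_of_mem := by
    rintro r x ⟨-, v, hv, S, -, rfl⟩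
    exact ⟨v, φ.mem_comp_self S v⟩
  rank_unique := by
    rintro r s x ⟨-, v, hv, S, hS, rfl⟩ hx
    obtain ⟨-, T, hT, h⟩ := exists_of_mem_ambientCell hx (φ.mem_comp_self S v)
    rw [← hS, ← hT, hI.comp_injective hg hv h]
  eq_singleton := by
    rintro x ⟨-, v, hv, S, hS, rfl⟩
    rw [Set.ncard_eq_zero] at hS
    exact ⟨v, by rw [hS, φ.comp_empty]⟩
  singleton_mem := by
    rintro r x hx v hv
    exact ⟨Nat.zero_le _, v, (exists_of_mem_ambientCell hx hv).1, ∅, by simp,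
      (φ.comp_empty v).symm⟩
  rank_lt := by
    rintro r s x y ⟨-, v, hv, S, rfl, rfl⟩ hy hxy
    obtain ⟨T, hST, rfl, rfl⟩ := hI.exists_of_mem_superset hg hv hy hxy.1
    exact Set.ncard_lt_ncard (hST.ssubset_of_ne fun h => hxy.ne (by rw [h])) (Set.toFinite _)
  inter_mem := by
    rintro r s x y hx hy ⟨v, hvx, hvy⟩
    have hr := hx.1
    -- Both cells are rewritten as components of a common vertex `v`.
    obtain ⟨hv, S, hS, rfl⟩ := exists_of_mem_ambientCell hx hvx
    obtain ⟨-, T, rfl, rfl⟩ := exists_of_mem_ambientCell hy hvy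
    refine ⟨(S ∩ T).ncard, ?_, v, hv, S ∩ T, rfl, hI.comp_inter hv S T⟩
    exact (Set.ncard_le_ncard Set.inter_subset_left (Set.toFinite _)).trans (hS.trans_le hr)
  exists_coface := by
    rintro r s x y ⟨-, v, hv, S, rfl, rfl⟩ hy hxy
    have hs := hy.1
    obtain ⟨T, hST, rfl, rfl⟩ := hI.exists_of_mem_superset hg hv hy hxy.1
    have hne : S ≠ T := fun h => hxy.ne (by rw [h])
    obtain ⟨c, hcT, hcS⟩ := Set.exists_of_ssubset (hST.ssubset_of_ne hne)
    have hcST := Set.insert_subset hcT hST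
    have hcard := Set.ncard_insert_of_notMem hcS (Set.toFinite S)
    refine ⟨_, ⟨?_, v, hv, insert c S, hcard, rfl⟩, φ.comp_mono (Set.subset_insert c S) v,
      φ.comp_mono hcST v⟩
    rw [← hcard]
    exact (Set.ncard_le_ncard hcST (Set.toFinite _)).trans hs
  diamond := by
    rintro r x y ⟨-, v, hv, S, rfl, rfl⟩ hy hxy
    have hs := hy.1
    obtain ⟨T, hST, hT, rfl⟩ := hI.exists_of_mem_superset hg hv hy hxy
    rw [hI.ncard_between hg hv (by omega)]
    have h : {c | c ∉ S ∧ insert c S ⊆ T} = T \ S := by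
      ext c
      simp only [Set.mem_ofPred_eq, Set.insert_subset_iff, Set.mem_sdiff]
      tauto
    rw [h, Set.ncard_sdiff hST, hT]
    omega

section Ambient

variable [Finite C] {hg : K.IsGraphBased} {hI : φ.IsNonsingular} {R : ℕ}

theorem ambient_cell_zero : (φ.ambient hg hI R).cell 0 = K.cell 0 := by
  ext x
  constructor
  · rintro ⟨-, v, hv, S, hS, rfl⟩
    rw [Set.ncard_eq_zero] at hS
    rw [hS, φ.comp_empty]
    exact hv
  · intro hx
    obtain ⟨v, rfl⟩ := K.eq_singleton x hx
    exact ⟨Nat.zero_le _, v, hx, ∅, by simp, (φ.comp_empty v).symm⟩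

theorem ambient_cell_one (hR : 1 ≤ R) : (φ.ambient hg hI R).cell 1 = K.cell 1 := by
  ext x
  constructor
  · rintro ⟨-, v, hv, S, hS, rfl⟩
    obtain ⟨c, rfl⟩ := Set.ncard_eq_one.1 hS
    obtain ⟨e, he, rfl⟩ := φ.surj v hv c
    rw [φ.comp_singleton hg he]
    exact he.1
  · intro hx
    obtain ⟨v, hv⟩ := K.nonempty_of_mem 1 x hx
    exact ⟨hR, v, mem_vertices_of_mem hx hv, _, Set.ncard_singleton (φ.color x),
      (φ.comp_singleton hg ⟨hx, hv⟩).symm⟩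

theorem ambient_cell_two (hlocal : K.IsLocal 2) (hfull : K.IsFull 2) (hR : 2 ≤ R) :
    (φ.ambient hg hI R).cell 2 = K.cell 2 := by
  ext x
  constructor
  · rintro ⟨-, v, hv, S, hS, rfl⟩
    obtain ⟨c, d, hcd, rfl⟩ := Set.ncard_eq_two.1 hS
    obtain ⟨e, he, rfl⟩ := φ.surj v hv c
    obtain ⟨f, hf, rfl⟩ := φ.surj v hv d
    obtain ⟨X, hX, -, h1, h2⟩ := hfull.exists_twoCell he hf fun h => hcd (h ▸ rfl)
    -- The 2-cell through `e` and `f` is a component for two colours, necessarily those of `e` and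
    -- `f`.
    obtain ⟨T, hT, hXT, h⟩ := φ.exists_comp_eq_of_twoCell hlocal hX (h1 he.2)
    have : {φ.color e, φ.color f} = T := by
      refine Set.eq_of_subset_of_ncard_le ?_ (by omega) (Set.toFinite _)
      rintro c (rfl | rfl)
      · exact (h v (h1 he.2) e he).1 h1
      · exact (h v (h1 he.2) f hf).1 h2
    rw [this, ← hXT]
    exact hX
  · intro hx
    obtain ⟨v, hv⟩ := K.nonempty_of_mem 2 x hx
    obtain ⟨T, hT, hXT, -⟩ := φ.exists_comp_eq_of_twoCell hlocal hx hv
    exact ⟨hR, v, mem_vertices_of_mem hx hv, T, hT, hXT⟩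

theorem skeleton_ambient (hlocal : K.IsLocal 2) (hfull : K.IsFull 2) (hR : 2 ≤ R) :
    (φ.ambient hg hI R).skeleton 2 = K := by
  refine ext_cell (funext fun r => ?_)
  have h : ((φ.ambient hg hI R).skeleton 2).cell r =
    {x | r ≤ 2 ∧ x ∈ (φ.ambient hg hI R).cell r} := rfl
  rw [h]
  rcases le_or_gt r 2 with hr | hr
  · simp only [hr, true_and]
    interval_cases r
    · exact ambient_cell_zero (hg := hg) (hI := hI)
    · exact ambient_cell_one (hg := hg) (hI := hI) (by omega)
    · exact ambient_cell_two (hg := hg) (hI := hI) hlocal hfull hR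
  · have : K.cell r = ∅ := by
      rw [← Set.not_nonempty_iff_eq_empty]
      intro h
      exact absurd (hlocal.1.1 r h) (by omega)
    rw [this]
    ext x
    simp [hr]

theorem vertices_ambient : (φ.ambient hg hI R).vertices = K.vertices := by
  simp only [vertices, ambient_cell_zero]

theorem graph_ambient (hR : 1 ≤ R) : (φ.ambient hg hI R).graph = K.graph := by
  ext a b
  simp only [graph_adj, ambient_cell_one hR]

theorem edgesAt_ambient (hR : 1 ≤ R) (v : V) :
    (φ.ambient hg hI R).edgesAt v = K.edgesAt v := by
  simp only [edgesAt, ambient_cell_one hR]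

theorem hasRank_ambient (hcard : R ≤ Nat.card C) (hne : K.vertices.Nonempty) :
    (φ.ambient hg hI R).HasRank R := by
  refine ⟨fun r ⟨x, hx⟩ => hx.1, fun n hn => hn R ?_⟩
  obtain ⟨v, hv⟩ := hne
  obtain ⟨S, -, -, hS⟩ := Set.exists_subsuperset_card_eq (n := R) (Set.empty_subset Set.univ)
    (by simp) (by rw [Set.ncard_univ]; exact hcard) (α := C)
  exact ⟨_, le_rfl, v, hv, S, hS, rfl⟩

theorem isGraphBased_ambient (hR : 1 ≤ R) : (φ.ambient hg hI R).IsGraphBased := by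
  intro e he
  rw [ambient_cell_one hR] at he
  exact hg e he

theorem isLocal_ambient (hlocal : K.IsLocal 2) (hR : 1 ≤ R) (hcard : R ≤ Nat.card C)
    (hne : K.vertices.Nonempty) : (φ.ambient hg hI R).IsLocal R := by
  have hgb := isGraphBased_ambient (hg := hg) (hI := hI) hR
  refine ⟨hasRank_ambient hcard hne, ⟨hgb, fun v hv w hw => ?_⟩, hgb, fun r x hx =>
    ⟨fun e he => hgb e he.1, fun a ha b hb => ?_⟩⟩
  · rw [vertices_ambient] at hv hw
    rw [graph_ambient hR]
    exact hlocal.2.1.2 v hv w hw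
  · obtain ⟨-, v, hv, S, -, rfl⟩ := hx
    refine φ.reachable_of_adj (S := S) (v := v) (fun x hx y hy h => ⟨h.1.1, ?_, ?_⟩)
      (ha.2 rfl) (hb.2 rfl)
    · rw [ambient_cell_one hR]
      exact h.1.2
    · rintro z (rfl | rfl) <;> assumption

theorem isFull_ambient (hR : 2 ≤ R) (hcard : R ≤ Nat.card C)
    (hne : K.vertices.Nonempty) : (φ.ambient hg hI R).IsFull R := by
  refine ⟨⟨R, hasRank_ambient hcard hne, hR, le_rfl⟩, fun v hv k hk hkR E hE hE' => ?_⟩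
  rw [vertices_ambient] at hv
  rw [edgesAt_ambient (by omega)] at hE
  refine ⟨φ.comp (φ.color '' E) v, ⟨hkR, v, hv, _, ?_, rfl⟩, ?_⟩
  · rw [← hE']
    exact Set.InjOn.ncard_image fun e he f hf h => φ.inj v e (hE he) f (hE hf) h
  · ext e
    simp only [edgesAtIn, edgesAt_ambient (show 1 ≤ R by omega), Set.mem_ofPred_eq]
    constructor
    · rintro ⟨he, hsub⟩
      -- Viewing `e` as the component of its own colour turns containment in the cell into
      -- membership of that colour.
      rw [← φ.comp_singleton hg he, hI.comp_subset_iff hg hv, Set.singleton_subset_iff] at hsub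
      obtain ⟨f, hf, hfe⟩ := hsub
      rwa [← φ.inj v f (hE hf) e he hfe]
    · intro he
      exact ⟨hE he, φ.edge_subset_comp hg (hE he) ⟨e, he, rfl⟩⟩

theorem isClosed_ambient (hR : 1 ≤ R) (hcard : Nat.card C = R + 1)
    (hne : K.vertices.Nonempty) : (φ.ambient hg hI R).IsClosed R := by
  refine ⟨isGraphBased_ambient hR, ⟨hasRank_ambient (by omega) hne, ?_⟩, ?_⟩
  · rintro r x ⟨hr, v, hv, S, rfl, rfl⟩ hmax
    by_contra h
    obtain ⟨c, hc⟩ : ∃ c, c ∉ S := by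
      by_contra! hall
      rw [Set.eq_univ_of_forall hall, Set.ncard_univ] at hr
      omega
    refine hmax (S.ncard + 1) (φ.comp (insert c S) v)
      ⟨by omega, v, hv, _, Set.ncard_insert_of_notMem hc, rfl⟩
      ((φ.comp_mono (Set.subset_insert c S) v).ssubset_of_ne fun h => hc ?_)
    rw [hI.comp_injective hg hv h]
    exact Set.mem_insert c S
  · rintro s hs y ⟨-, v, hv, S, rfl, rfl⟩
    have h1 := hI.ncard_between (R := R) hg hv (S := S) (T := Set.univ) hs.le
    have h2 : {c | c ∉ S ∧ insert c S ⊆ Set.univ} = Sᶜ := by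
      ext c
      simp
    rw [h2, Set.ncard_compl] at h1
    -- The component for all colours acts as a formal top. Since `S` has `R - 1` of the `R + 1`
    -- colours, exactly two can be added.
    have h3 : {z | z ∈ (φ.ambient hg hI R).cell R ∧ φ.comp S v ⊆ z} =
        {z | z ∈ φ.ambientCell R (S.ncard + 1) ∧ φ.comp S v ⊆ z ∧ z ⊆ φ.comp Set.univ v} := by
      rw [hs]
      ext z
      refine ⟨fun hz => ⟨hz.1, hz.2, ?_⟩, fun hz => ⟨hz.1, hz.2.1⟩⟩
      obtain ⟨T, -, -, rfl⟩ := hI.exists_of_mem_superset hg hv hz.1 hz.2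
      exact φ.comp_mono (Set.subset_univ T) v
    rw [h3, h1]
    omega

end Ambient

end EdgeColoring

/-! ### Evenness and simple connectivity only depend on the `2`-skeleton -/

theorem isTwoCellComponent_congr {A B : CellComplex V} (h1 : A.cell 1 = B.cell 1)
    (h2 : A.cell 2 = B.cell 2) : A.IsTwoCellComponent = B.IsTwoCellComponent := by
  have h : ∀ x, (A.restrict x).graph = (B.restrict x).graph := by
    intro x
    ext a b
    simp only [graph_adj, restrict, h1]
  funext D
  simp only [IsTwoCellComponent, h, h2]

/-- The moves of paths in a graph, with given loops. -/
inductive GraphMove (G : SimpleGraph V) (P : Set V → Prop) :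
    {v w : V} → G.Walk v w → G.Walk v w → Prop
  | cell {v a b w : V} (q₁ : G.Walk v a) (p p' : G.Walk a b) (q₂ : G.Walk b w)
      (D : Set V) (hD : P D) (hl : (p.append p'.reverse).IsCycle ∧
        {x | x ∈ (p.append p'.reverse).support} = D) :
      GraphMove G P ((q₁.append p).append q₂) ((q₁.append p').append q₂)
  | edge {v a b w : V} (q₁ : G.Walk v a) (h : G.Adj a b) (q₂ : G.Walk a w) :
      GraphMove G P (q₁.append (.cons h (.cons h.symm q₂))) (q₁.append q₂)

theorem move_iff {v w : V} {p q : K.graph.Walk v w} :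
    K.Move p q ↔ GraphMove K.graph K.IsTwoCellComponent p q := by
  constructor
  · rintro (⟨q₁, p, p', q₂, D, hD, hl⟩ | ⟨q₁, h, q₂⟩)
    · exact .cell q₁ p p' q₂ D hD hl
    · exact .edge q₁ h q₂
  · rintro (⟨q₁, p, p', q₂, D, hD, hl⟩ | ⟨q₁, h, q₂⟩)
    · exact .cell q₁ p p' q₂ D hD hl
    · exact .edge q₁ h q₂

theorem isSimplyConnected_iff : K.IsSimplyConnected ↔ K.IsGraphBased ∧ ∀ v ∈ K.vertices,
    ∀ p : K.graph.Walk v v,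
      Relation.EqvGen (fun a b => GraphMove K.graph K.IsTwoCellComponent a b) p .nil := by
  simp only [IsSimplyConnected, Homotopic, move_iff]

/-- Walk types depend on the graph, so `Move` does not transfer by rewriting between complexes.
`GraphMove` sees the complex only through its graph and a predicate on sets, both of which can be
rewritten. -/
theorem IsSimplyConnected.congr {A B : CellComplex V} (h0 : A.cell 0 = B.cell 0)
    (h1 : A.cell 1 = B.cell 1) (h2 : A.cell 2 = B.cell 2) (h : B.IsSimplyConnected) :
    A.IsSimplyConnected := by
  have hgraph : A.graph = B.graph := by
    ext a b
    simp only [graph_adj, h1]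
  have hv : A.vertices = B.vertices := by simp only [vertices, h0]
  have hb : A.IsGraphBased ↔ B.IsGraphBased := by simp only [IsGraphBased, h1]
  rw [isSimplyConnected_iff] at h ⊢
  rw [isTwoCellComponent_congr h1 h2, hgraph, hv, hb]
  exact h

theorem IsEven.congr {A B : CellComplex V} (h1 : A.cell 1 = B.cell 1)
    (h2 : A.cell 2 = B.cell 2) (h : B.IsEven) : A.IsEven := by
  intro D hD
  rw [isTwoCellComponent_congr h1 h2] at hD
  exact h D hD

end CellComplex

/-! ### The main theorem. -/

theorem mainTheorem3 {V : Type*} (K : CellComplex V) (hlocal : K.IsLocal 2) (heven : K.IsEven)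
    (hfull : K.IsFull 2) (hmonodromy : K.IsMonodromyFree) (hsimply : K.IsSimplyConnected)
    (R : ℕ) (hR : IsGreatest {r : ℕ | (K.inducedCells r).Nonempty} R)
    (hnonsing : ∀ r, 2 ≤ r → r ≤ R → K.NonsingularInducedCells r) :
    ∃ Kamb : CellComplex V, Kamb.IsLocal R ∧ Kamb.IsEven ∧ Kamb.IsSimplyConnected ∧
      Kamb.IsSimple R ∧ Kamb.skeleton 2 = K := by
  obtain ⟨v₀, hv₀, e₀, he₀⟩ : ∃ v ∈ K.vertices, ∃ e, e ∈ K.edgesAt v := by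
    obtain ⟨x, J, ⟨v, hv, E, hE, -⟩, -⟩ := hR.1
    obtain ⟨e, he, -⟩ := Set.exists_of_ssubset hE
    exact ⟨v, hv, e, he⟩
  have hg := hlocal.2.1.1
  obtain ⟨φ⟩ := CellComplex.exists_edgeColoring hlocal heven hfull hmonodromy hsimply hv₀ he₀
  -- The colours are the edges at `v₀`, which are subsets of the finite vertex set.
  have hfin : Finite (K.edgesAt v₀) := by
    refine Set.Finite.subset K.finite_vertices.powerset fun e he x hx => ?_
    exact CellComplex.mem_vertices_of_mem he.1 hx
  obtain ⟨hR2, hcard⟩ := φ.card_eq_of_isGreatest hlocal heven hfull hmonodromy hR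
  have hI : φ.IsNonsingular := fun v hv S T w =>
    φ.reachable_inter hlocal heven hfull hmonodromy hcard hnonsing hv _ S T w rfl
  have h0 := CellComplex.EdgeColoring.ambient_cell_zero (hg := hg) (hI := hI) (R := R)
  have h1 := CellComplex.EdgeColoring.ambient_cell_one (hg := hg) (hI := hI) (R := R) (by omega)
  have h2 := CellComplex.EdgeColoring.ambient_cell_two (hg := hg) (hI := hI) hlocal hfull hR2
  exact ⟨φ.ambient hg hI R,
    CellComplex.EdgeColoring.isLocal_ambient hlocal (by omega) (by omega) ⟨v₀, hv₀⟩,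
    heven.congr h1 h2, hsimply.congr h0 h1 h2,
    ⟨CellComplex.EdgeColoring.isClosed_ambient (by omega) hcard ⟨v₀, hv₀⟩, fun _ =>
      CellComplex.EdgeColoring.isFull_ambient hR2 (by omega) ⟨v₀, hv₀⟩⟩,
    CellComplex.EdgeColoring.skeleton_ambient hlocal hfull hR2⟩
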